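/- For $d \ge 1$, a finite simple graph $G$ is said to be realizable as a faithful (unit) distance graph in $\mathbb{R}^d$ if there is a set $S \subset \mathbb{R}^d$ such that $G$ is isomorphic to the graph with vertex set $S$ in which two points are adjacent if and only if their Euclidean distance is exactly $1$. Let $g_2(d)$ be the minimum possible number of edges of a finite bipartite graph that is not realizable as a faithful distance graph in $\mathbb{R}^d$. Then for every integer $d \ge 4$ this minimum exists (that is, there is such a bipartite graph), and $$\binom{d+2}{2} \le g_2(d) \le \binom{d+3}{2} - 6 .$$ -/

import Mathlib

/-- The faithful unit distance graph on a set `S` of points of `ℝ^d`: two points of `S` are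
adjacent exactly when their Euclidean distance is `1`. -/
def faithfulDistanceGraph (d : ℕ) (S : Set (EuclideanSpace ℝ (Fin d))) : SimpleGraph S where
  Adj x y := dist (x : EuclideanSpace ℝ (Fin d)) (y : EuclideanSpace ℝ (Fin d)) = 1
  symm := ⟨fun x y h => by rw [dist_comm]; exact h⟩
  loopless := ⟨fun x h => by simp at h⟩

/-- `G` is realizable as a faithful distance graph in `ℝ^d`: it is isomorphic to the faithful
unit distance graph on some set of points of `ℝ^d`. -/
def IsFaithfullyRealizable {V : Type*} (G : SimpleGraph V) (d : ℕ) : Prop :=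
  ∃ S : Set (EuclideanSpace ℝ (Fin d)), Nonempty (G ≃g faithfulDistanceGraph d S)

/-- The numbers of edges of the finite bipartite graphs that are not realizable as faithful
distance graphs in `ℝ^d`. -/
def nonRealizableBipartiteEdgeCounts (d : ℕ) : Set ℕ :=
  {m | ∃ (V : Type) (_ : Finite V) (G : SimpleGraph V),
    G.IsBipartite ∧ ¬ IsFaithfullyRealizable G d ∧ G.edgeSet.ncard = m}

/-- The minimum possible number of edges of a finite bipartite graph that is not realizable as a
faithful distance graph in `ℝ^d`. -/
noncomputable def g₂ (d : ℕ) : ℕ := sInf (nonRealizableBipartiteEdgeCounts d)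

/-!
**Upper bound.** In the graph `halfGraph d`, each `a_k` with `k ≥ 3` is separated from its
predecessors by a vertex `b_k` that is adjacent to these only. If `c` is adjacent to all `a_j`, then
the bisector of `c` and `b_k` contains the predecessors of `a_k` but not `a_k`; as three points of a
sphere are not collinear, the `d` points `a_j` are affinely independent in any faithful realization.
So only a line is left for their three common neighbours, which lie on a sphere: a contradiction
(`not_isFaithfullyRealizable_halfGraph`).

**Lower bound.** Let `G` be bipartite with classes `A`, `B` and fewer than `(d + 2).choose 2` edges.
All constructions keep `B` on a small sphere about the origin (`HasSphericalRep`). Two mechanisms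
carry the proof.

* Generic placement (`hasSphericalRep_of_card_le`): if `B` is in general position on the sphere, a
  vertex of `A` with fewer than `d` neighbours can be chosen from a sphere of positive dimension,
  and a generic point of it has no unwanted unit distances. Two vertices with exactly `d` neighbours
  can be handled too, as there are two candidates for each.
* One more dimension accommodates one more vertex of `A`, of any degree
  (`HasSphericalRep.insert_vertex`): `B` is split between two parallel slices of a slightly larger
  sphere, one of them containing the neighbours of the new vertex, which is placed on the axis.

A vertex of degree at least `d + 1`, or three vertices of degree `d`, are therefore removed and the
dimension is lowered by one or three; the bound on the number of edges drops by `d + 1` or `3 * d`,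
so it is preserved. This ends in the generic case unless the dimension gets too small, and that
happens only when nearly all edges lie at `d` vertices of `A`
(`hasSphericalRep_or_isConcentrated`). Vertices of `A` of degree at most one can be added at the very
end, so in this exceptional case `A` has at most `d` vertices. Then the classes are exchanged: `A` is
put on the sphere and the generic placement applies, except when three vertices of `B` are adjacent
to all of `A`. In that situation three vertices of `A` have no further neighbours, and `A` can be
placed with one coplanar quadruple, so that it spans only a flat of codimension two
(`hasSphericalRep_of_card_eq`, `hasSphericalRep_or_hasSphericalRep_symm`).
-/

/-! ### Unit vectors of a subspace off finitely many hyperplanes -/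

/-- A nonzero subspace `W` contains a unit vector that is orthogonal to none of finitely many given
vectors, provided none of them is orthogonal to all of `W`. -/
theorem exists_unit_inner_ne_zero {E : Type*} [NormedAddCommGroup E] [InnerProductSpace ℝ E]
    (W : Submodule ℝ E) (hW : W ≠ ⊥) (F : Finset E) (hF : ∀ u ∈ F, u ∉ Wᗮ) :
    ∃ e ∈ W, ‖e‖ = 1 ∧ ∀ u ∈ F, inner ℝ e u ≠ 0 := by
  classical
  obtain ⟨w, hw, hw0⟩ := (Submodule.ne_bot_iff W).1 hW
  have hG : ∀ u ∈ insert w F, u ∉ Wᗮ := by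
    intro u hu hmem
    rcases Finset.mem_insert.1 hu with rfl | hu
    · exact hw0 (inner_self_eq_zero.1 (hmem u hw))
    · exact hF u hu hmem
  obtain ⟨e, he, hne⟩ := Module.Dual.exists_forall_mem_ne_zero_of_forall_exists (K := ℝ) W
    (fun u : (insert w F : Finset E) => (innerₛₗ ℝ (u : E) : E →ₗ[ℝ] ℝ)) (by
      rintro ⟨u, hu⟩
      have := hG u hu
      rw [Submodule.mem_orthogonal'] at this
      push Not at this
      obtain ⟨v, hv, h⟩ := this
      exact ⟨v, hv, by simpa using h⟩)
  have hne' : ∀ u ∈ insert w F, inner ℝ e u ≠ 0 := by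
    intro u hu
    have := hne ⟨u, hu⟩
    rw [real_inner_comm]
    simpa using this
  have he0 : e ≠ 0 := by
    rintro rfl
    exact hne' w (Finset.mem_insert_self _ _) (by simp)
  have hn : ‖e‖ ≠ 0 := norm_ne_zero_iff.2 he0
  refine ⟨‖e‖⁻¹ • e, W.smul_mem _ he, ?_, fun u hu => ?_⟩
  · rw [norm_smul, norm_inv, norm_norm, inv_mul_cancel₀ hn]
  · rw [real_inner_smul_left]
    exact mul_ne_zero (inv_ne_zero hn) (hne' u (Finset.mem_insert_of_mem hu))

open Polynomial in
/-- The unit sphere of a subspace `W` of dimension at least two is not covered by finitely many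
hyperplanes `⟪·, u⟫ = κ`, none of which is parallel to all of `W`. -/
theorem exists_unit_inner_ne {E : Type*} [NormedAddCommGroup E] [InnerProductSpace ℝ E]
    (W : Submodule ℝ E) (hW : 2 ≤ Module.finrank ℝ W) (F : Finset (E × ℝ))
    (hF : ∀ p ∈ F, p.1 ∉ Wᗮ) :
    ∃ w ∈ W, ‖w‖ = 1 ∧ ∀ p ∈ F, inner ℝ w p.1 ≠ p.2 := by
  classical
  have : FiniteDimensional ℝ W := Module.finite_of_finrank_pos (by omega)
  have hWbot : W ≠ ⊥ := by
    rintro rfl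
    simp at hW
  obtain ⟨e, he, hen, heF⟩ := exists_unit_inner_ne_zero W hWbot (F.image Prod.fst) (by
    intro u hu
    obtain ⟨p, hp, rfl⟩ := Finset.mem_image.1 hu
    exact hF p hp)
  -- a unit vector of `W` orthogonal to `e`
  obtain ⟨f, hf, hfn, hef⟩ : ∃ f ∈ W, ‖f‖ = 1 ∧ inner ℝ e f = 0 := by
    have hlt : Submodule.span ℝ {e} < W := by
      refine lt_of_le_of_ne ((Submodule.span_singleton_le_iff_mem _ _).2 he) ?_
      intro h
      have := finrank_span_singleton (K := ℝ) (v := e) (by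
        rintro rfl
        simp at hen)
      rw [h] at this
      omega
    obtain ⟨g, hg, hge⟩ := SetLike.exists_of_lt hlt
    set f := g - inner ℝ e g • e with hfdef
    have hf0 : f ≠ 0 := by
      intro h
      apply hge
      rw [sub_eq_zero.1 h]
      exact Submodule.smul_mem _ _ (Submodule.mem_span_singleton_self e)
    have hef : inner ℝ e f = 0 := by
      rw [hfdef, inner_sub_right, real_inner_smul_right, real_inner_self_eq_norm_sq, hen]
      ring
    refine ⟨‖f‖⁻¹ • f, W.smul_mem _ (W.sub_mem hg (W.smul_mem _ he)), ?_, ?_⟩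
    · rw [norm_smul, norm_inv, norm_norm, inv_mul_cancel₀ (norm_ne_zero_iff.2 hf0)]
    · rw [real_inner_smul_right, hef, mul_zero]
  -- each hyperplane meets the rationally parametrized circle in finitely many parameters
  let q : E × ℝ → ℝ[X] := fun p =>
    C (inner ℝ e p.1) * (1 - X ^ 2) + C (inner ℝ f p.1) * (2 * X) - C p.2 * (1 + X ^ 2)
  have hq : ∀ p ∈ F, q p ≠ 0 := by
    intro p hp h
    have h0 := congrArg (eval 0) h
    have h1 := congrArg (eval 1) h
    have h2 := congrArg (eval (-1)) h
    have h3 := congrArg (eval 2) h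
    have := heF p.1 (Finset.mem_image_of_mem _ hp)
    simp only [q, eval_sub, eval_add, eval_mul, eval_C, eval_one, eval_pow, eval_X, eval_zero,
      eval_ofNat] at h0 h1 h2 h3
    apply this
    linarith
  obtain ⟨t, ht⟩ := Infinite.exists_notMem_finset (F.biUnion fun p => (q p).roots.toFinset)
  have hpos : (0 : ℝ) < 1 + t ^ 2 := by positivity
  refine ⟨(1 + t ^ 2)⁻¹ • ((1 - t ^ 2) • e + (2 * t) • f),
    W.smul_mem _ (W.add_mem (W.smul_mem _ he) (W.smul_mem _ hf)), ?_, ?_⟩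
  · have : ‖(1 - t ^ 2) • e + (2 * t) • f‖ ^ 2 = (1 + t ^ 2) ^ 2 := by
      rw [norm_add_sq_real, norm_smul, norm_smul, real_inner_smul_left, real_inner_smul_right,
        hef, hen, hfn, Real.norm_eq_abs, Real.norm_eq_abs, mul_one, mul_one, sq_abs, sq_abs]
      ring
    have h' : ‖(1 - t ^ 2) • e + (2 * t) • f‖ = 1 + t ^ 2 :=
      (pow_left_inj₀ (norm_nonneg _) hpos.le two_ne_zero).1 this
    rw [norm_smul, h', norm_inv, Real.norm_eq_abs, abs_of_pos hpos, inv_mul_cancel₀ hpos.ne']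
  · intro p hp h
    apply ht
    rw [Finset.mem_biUnion]
    refine ⟨p, hp, ?_⟩
    rw [Multiset.mem_toFinset, mem_roots (hq p hp), IsRoot.def]
    rw [real_inner_smul_left, inner_add_left, real_inner_smul_left, real_inner_smul_left,
      inv_mul_eq_iff_eq_mul₀ hpos.ne'] at h
    simp only [q, eval_sub, eval_add, eval_mul, eval_C, eval_one, eval_pow, eval_X,
      eval_ofNat]
    linarith

/-- If the points of a sphere of radius `r < 1` about `0` that lie in the flat `c + V` are to be at
distance `1` from a new point, and `V` has codimension at least two, then the new point can be
chosen so that its squared distances to finitely many points `z` avoid given values `τ`, and such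
that it is far from `0`. The only obstruction is a point `z` of the flat whose squared distance to
*every* candidate is `τ`, that is `‖z‖ ^ 2 - r ^ 2 + 1 = τ`. -/
theorem exists_unit_dist_avoiding {E : Type*} [NormedAddCommGroup E] [InnerProductSpace ℝ E]
    [FiniteDimensional ℝ E] (V : Submodule ℝ E) (c : E)
    (hV : Module.finrank ℝ V + 2 ≤ Module.finrank ℝ E) (r : ℝ) (hr : r < 1)
    (hcr : ‖c‖ ≤ r) (Z : Finset (E × ℝ)) (hZ : ∀ p ∈ Z, p.1 - c ∈ V → ‖p.1‖ ^ 2 - r ^ 2 + 1 ≠ p.2) :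
    ∃ x : E, (∀ y, ‖y‖ = r → y - c ∈ V → ‖x - y‖ ^ 2 = 1) ∧ (∀ p ∈ Z, ‖x - p.1‖ ^ 2 ≠ p.2) ∧
      1 - r ≤ ‖x‖ := by
  classical
  -- replace `c` by the foot of the perpendicular from `0`
  wlog hc : c ∈ Vᗮ generalizing c
  · set c' := c - V.starProjection c with hc'
    have hmem : ∀ z, z - c' ∈ V ↔ z - c ∈ V := by
      intro z
      have : z - c' = (z - c) + V.starProjection c := by rw [hc']; abel
      rw [this]
      exact V.add_mem_iff_left (Submodule.starProjection_apply_mem V c)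
    obtain ⟨x, h1, h2, h3⟩ := this c' (by
        rw [hc', ← Submodule.starProjection_orthogonal_val]
        exact (Submodule.norm_starProjection_apply_le _ _).trans hcr)
      (fun p hp h => hZ p hp ((hmem _).1 h))
      (Submodule.sub_starProjection_mem_orthogonal c)
    exact ⟨x, fun y hy h => h1 y hy ((hmem _).2 h), h2, h3⟩
  have hW : 2 ≤ Module.finrank ℝ Vᗮ := by
    have := V.finrank_add_finrank_orthogonal
    omega
  set s := Real.sqrt (1 - r ^ 2 + ‖c‖ ^ 2) with hs
  have hc0 := norm_nonneg c
  have hs0 : 0 < 1 - r ^ 2 + ‖c‖ ^ 2 := by nlinarith [sq_nonneg ‖c‖]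
  have hspos : 0 < s := Real.sqrt_pos.2 hs0
  have hs2 : s ^ 2 = 1 - r ^ 2 + ‖c‖ ^ 2 := Real.sq_sqrt hs0.le
  have key : ∀ w z : E, w ∈ Vᗮ → ‖w‖ = 1 →
      ‖c + s • w - z‖ ^ 2 = ‖c - z‖ ^ 2 + s ^ 2 + 2 * s * inner ℝ w (c - z) := by
    intro w z hw hwn
    have : c + s • w - z = (c - z) + s • w := by abel
    rw [this, norm_add_sq_real, norm_smul, hwn, real_inner_smul_right, Real.norm_eq_abs, mul_one,
      sq_abs, real_inner_comm]
    ring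
  have flat : ∀ z, z - c ∈ V → ‖c - z‖ ^ 2 = ‖z‖ ^ 2 - ‖c‖ ^ 2 := by
    intro z hz
    have h : inner ℝ (z - c) c = 0 := hc _ hz
    have h2 : ‖z‖ ^ 2 = ‖(z - c) + c‖ ^ 2 := by rw [sub_add_cancel]
    rw [norm_add_sq_real, h] at h2
    rw [norm_sub_rev]
    linarith
  have perp : ∀ z w, z - c ∈ V → w ∈ Vᗮ → inner ℝ w (c - z) = 0 := by
    intro z w hz hw
    have := hw _ hz
    rw [real_inner_comm] at this
    rw [← neg_sub, inner_neg_right, this, neg_zero]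
  obtain ⟨w, hw, hwn, hwF⟩ := exists_unit_inner_ne Vᗮ hW
    ((Z.filter fun p => p.1 - c ∉ V).image fun p =>
      (c - p.1, (p.2 - ‖c - p.1‖ ^ 2 - s ^ 2) / (2 * s))) (by
    intro p hp
    obtain ⟨q, hq, rfl⟩ := Finset.mem_image.1 hp
    rw [Submodule.orthogonal_orthogonal]
    intro h
    apply (Finset.mem_filter.1 hq).2
    simpa using V.neg_mem h)
  refine ⟨c + s • w, ?_, ?_, ?_⟩
  · intro y hy hyV
    rw [key w y hw hwn, flat y hyV, perp y w hyV hw, hs2, hy]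
    ring
  · intro p hp h
    rw [key w p.1 hw hwn] at h
    by_cases hpV : p.1 - c ∈ V
    · apply hZ p hp hpV
      rw [flat _ hpV, perp _ w hpV hw, hs2] at h
      linarith
    · refine hwF _ (Finset.mem_image_of_mem _ (Finset.mem_filter.2 ⟨hp, hpV⟩)) ?_
      rw [eq_div_iff (by positivity)]
      simp only
      linarith
  · have h1 : s - ‖c‖ ≤ ‖c + s • w‖ := by
      have := norm_sub_norm_le (s • w) (-c)
      rwa [norm_smul, hwn, mul_one, Real.norm_eq_abs, abs_of_pos hspos, norm_neg, sub_neg_eq_add,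
        add_comm] at this
    -- `(s - ‖c‖) * (s + ‖c‖) = (1 - r) * (1 + r)`, and `s + ‖c‖ ≤ 1 + r`
    have h2 : s ≤ 1 := by nlinarith
    nlinarith

/-! ### Placing vertices one by one -/

/-- A bipartite graph with classes `A` and `B` is given by the neighbourhoods `N a : Finset B` of
the vertices `a : A`. A *placement* of the set `S` of vertices in `A`, relative to given points
`y b` on the sphere of radius `r` about `0`, consists of points `x a`, for `a ∈ S`, outside that
sphere such that distance `1` means adjacency. -/
structure IsPlacement {d : ℕ} {A B : Type*} (r : ℝ) (N : A → Finset B)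
    (y : B → EuclideanSpace ℝ (Fin d)) (S : Finset A) (x : A → EuclideanSpace ℝ (Fin d)) :
    Prop where
  far : ∀ a ∈ S, r < ‖x a‖
  adj : ∀ a ∈ S, ∀ b, ‖x a - y b‖ ^ 2 = 1 ↔ b ∈ N a
  sep : ∀ a ∈ S, ∀ a' ∈ S, a ≠ a' → x a ≠ x a' ∧ ‖x a - x a'‖ ^ 2 ≠ 1

/-- The points `y b` with `b ∈ M` are those among all `y b` that lie in a certain flat `c + V` of
codimension at least two that comes within distance `r` of the origin. -/
def IsCutOutByFlat {d : ℕ} {B : Type*} (r : ℝ) (y : B → EuclideanSpace ℝ (Fin d))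
    (M : Finset B) : Prop :=
  ∃ (c : EuclideanSpace ℝ (Fin d)) (V : Submodule ℝ (EuclideanSpace ℝ (Fin d))),
    ‖c‖ ≤ r ∧ Module.finrank ℝ V + 2 ≤ d ∧ ∀ b, y b - c ∈ V ↔ b ∈ M

section Placement

variable {d : ℕ} {A B : Type*} {r : ℝ} {N : A → Finset B} {y : B → EuclideanSpace ℝ (Fin d)}
  {S : Finset A} {x : A → EuclideanSpace ℝ (Fin d)}

theorem IsPlacement.insert_point [DecidableEq A] (h : IsPlacement r N y S x) {a : A} (ha : a ∉ S)
    {p : EuclideanSpace ℝ (Fin d)} (hfar : r < ‖p‖) (hadj : ∀ b, ‖p - y b‖ ^ 2 = 1 ↔ b ∈ N a)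
    (hsep : ∀ a' ∈ S, p ≠ x a' ∧ ‖p - x a'‖ ^ 2 ≠ 1) :
    IsPlacement r N y (insert a S) (Function.update x a p) := by
  have hne : ∀ a' ∈ S, a' ≠ a := fun a' h' e => ha (e ▸ h')
  refine ⟨fun b hb => ?_, fun b hb => ?_, fun b hb b' hb' hbb' => ?_⟩
  · rcases Finset.mem_insert.1 hb with rfl | hb
    · simpa using hfar
    · rw [Function.update_of_ne (hne b hb)]
      exact h.far b hb
  · rcases Finset.mem_insert.1 hb with rfl | hb
    · simpa using hadj
    · rw [Function.update_of_ne (hne b hb)]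
      exact h.adj b hb
  · rcases Finset.mem_insert.1 hb with e | hS <;> rcases Finset.mem_insert.1 hb' with e' | hS'
    · exact absurd (e.trans e'.symm) hbb'
    · rw [e, Function.update_of_ne (hne b' hS'), Function.update_self]
      exact hsep b' hS'
    · rw [e', Function.update_of_ne (hne b hS), Function.update_self, norm_sub_rev]
      exact ⟨(hsep b hS).1.symm, (hsep b hS).2⟩
    · rw [Function.update_of_ne (hne b hS), Function.update_of_ne (hne b' hS')]
      exact h.sep b hS b' hS' hbb'

/-- A vertex whose neighbours are cut out by a flat of codimension two can be added to a placement: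
the candidates for the new point form a sphere of positive dimension. -/
theorem IsPlacement.exists_insert [Fintype B] [DecidableEq A] (h : IsPlacement r N y S x)
    (hr : r < 1 / 2) (hy : ∀ b, ‖y b‖ = r) {a : A} (ha : a ∉ S)
    (hflat : IsCutOutByFlat r y (N a)) : ∃ x', IsPlacement r N y (insert a S) x' := by
  classical
  obtain ⟨c, V, hc, hV, hcV⟩ := hflat
  have hr0 : 0 ≤ r := (norm_nonneg c).trans hc
  obtain ⟨p, hp1, hp2, hp3⟩ := exists_unit_dist_avoiding V c (by simpa using hV) r (by linarith) hc
    ((Finset.univ.filter fun b => b ∉ N a).image (fun b => (y b, (1 : ℝ))) ∪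
      (S.image (fun a' => (x a', (1 : ℝ))) ∪ S.image (fun a' => (x a', (0 : ℝ))))) (by
    intro q hq hqV
    simp only [Finset.mem_union, Finset.mem_image, Finset.mem_filter, Finset.mem_univ,
      true_and] at hq
    rcases hq with ⟨b, hb, rfl⟩ | ⟨a', ha', rfl⟩ | ⟨a', ha', rfl⟩
    · exact absurd ((hcV b).1 hqV) hb
    · have := h.far a' ha'
      simp only
      nlinarith
    · have := h.far a' ha'
      simp only
      nlinarith)
  refine ⟨_, h.insert_point ha (p := p) (by linarith) (fun b => ⟨fun hb => ?_, fun hb => ?_⟩)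
    (fun a' ha' => ⟨?_, ?_⟩)⟩
  · by_contra hbN
    exact hp2 (y b, 1) (Finset.mem_union_left _ (Finset.mem_image_of_mem _ (by simpa using hbN))) hb
  · exact hp1 _ (hy b) ((hcV b).2 hb)
  · rintro rfl
    exact hp2 (x a', 0) (Finset.mem_union_right _ (Finset.mem_union_right _
      (Finset.mem_image_of_mem _ ha'))) (by simp)
  · exact hp2 (x a', 1) (Finset.mem_union_right _ (Finset.mem_union_left _
      (Finset.mem_image_of_mem _ ha')))

theorem IsPlacement.exists_extension [Fintype B] [DecidableEq A] (h : IsPlacement r N y S x)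
    (hr : r < 1 / 2) (hy : ∀ b, ‖y b‖ = r) (T : Finset A)
    (hflat : ∀ a ∈ T, a ∉ S → IsCutOutByFlat r y (N a)) :
    ∃ x', IsPlacement r N y (S ∪ T) x' := by
  induction T using Finset.induction_on with
  | empty => exact ⟨x, by simpa using h⟩
  | insert a T _ ih =>
    obtain ⟨x', hx'⟩ := ih fun a ha => hflat a (Finset.mem_insert_of_mem ha)
    rw [Finset.union_insert]
    by_cases ha : a ∈ S ∪ T
    · rw [Finset.insert_eq_of_mem ha]
      exact ⟨x', hx'⟩
    · exact hx'.exists_insert hr hy ha (hflat a (Finset.mem_insert_self _ _)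
        fun h => ha (Finset.mem_union_left _ h))

end Placement

section GeneralPosition

theorem mem_affineSpan_insert_exchange {E : Type*} [AddCommGroup E] [Module ℝ E] {s : Set E}
    {p q : E} (hp : p ∈ affineSpan ℝ (insert q s)) (hps : p ∉ affineSpan ℝ s) :
    q ∈ affineSpan ℝ (insert p s) := by
  rcases s.eq_empty_or_nonempty with rfl | ⟨o, ho⟩
  · simp at hp ⊢
    exact hp.symm
  have ho' : o ∈ affineSpan ℝ s := mem_affineSpan ℝ ho
  have hspan : ∀ q : E, affineSpan ℝ (insert q s) = affineSpan ℝ (insert q (affineSpan ℝ s)) :=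
    fun q => (affineSpan_insert_affineSpan ℝ q s).symm
  rw [hspan, AffineSubspace.mem_affineSpan_insert_iff ho'] at hp ⊢
  obtain ⟨t, p0, hp0, rfl⟩ := hp
  have ht : t ≠ 0 := by
    rintro rfl
    exact hps (by simpa using hp0)
  refine ⟨t⁻¹, -t⁻¹ • (p0 -ᵥ o) +ᵥ o, AffineSubspace.smul_vsub_vadd_mem _ _ hp0 ho' ho', ?_⟩
  simp only [vsub_eq_sub, vadd_eq_add]
  rw [add_sub_assoc, smul_add, smul_smul, inv_mul_cancel₀ ht, one_smul]
  module

/-- The affine span of at most `d` points of `ℝ^d` lies in a hyperplane. -/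
theorem exists_hyperplane_of_card_le {d : ℕ} (hd : 0 < d) (s : Finset (EuclideanSpace ℝ (Fin d)))
    (hs : s.card ≤ d) : ∃ (u : EuclideanSpace ℝ (Fin d)) (κ : ℝ), u ≠ 0 ∧
      ∀ p ∈ affineSpan ℝ (s : Set (EuclideanSpace ℝ (Fin d))), inner ℝ p u = κ := by
  classical
  rcases s.eq_empty_or_nonempty with rfl | ⟨o, ho⟩
  · have : Nontrivial (EuclideanSpace ℝ (Fin d)) := by
      apply Module.nontrivial_of_finrank_pos (R := ℝ)
      simpa using hd
    obtain ⟨u, hu⟩ := exists_ne (0 : EuclideanSpace ℝ (Fin d))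
    exact ⟨u, 0, hu, fun p hp => by simp at hp; exact hp.elim⟩
  · have hpos : 0 < s.card := Finset.card_pos.2 ⟨o, ho⟩
    have hfin := finrank_vectorSpan_image_finset_le ℝ (id : EuclideanSpace ℝ (Fin d) → _) s
      (n := s.card - 1) (by omega)
    rw [Finset.image_id] at hfin
    have hadd := (vectorSpan ℝ (s : Set (EuclideanSpace ℝ (Fin d)))).finrank_add_finrank_orthogonal
    rw [finrank_euclideanSpace_fin] at hadd
    obtain ⟨u, hu, hu0⟩ := (Submodule.ne_bot_iff
      (vectorSpan ℝ (s : Set (EuclideanSpace ℝ (Fin d))))ᗮ).1 (by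
        intro h
        rw [h] at hadd
        simp at hadd
        omega)
    refine ⟨u, inner ℝ o u, hu0, fun p hp => ?_⟩
    have hm : p -ᵥ o ∈ vectorSpan ℝ (s : Set (EuclideanSpace ℝ (Fin d))) := by
      rw [← direction_affineSpan]
      exact AffineSubspace.vsub_mem_direction hp (mem_affineSpan ℝ ho)
    have := hu _ hm
    rw [vsub_eq_sub, inner_sub_left] at this
    linarith

/-- Every finite set can be mapped to a given sphere about `0` in general position: no point lies
in the affine span of `d` others. -/
theorem exists_generalPosition_on_sphere {d : ℕ} (hd : 2 ≤ d) {B : Type*} [Fintype B] {r : ℝ}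
    (hr : 0 < r) : ∃ y : B → EuclideanSpace ℝ (Fin d), (∀ b, ‖y b‖ = r) ∧
      ∀ (M : Finset B) (b : B), M.card ≤ d → b ∉ M → y b ∉ affineSpan ℝ (y '' M) := by
  classical
  suffices H : ∀ T : Finset B, ∃ y : B → EuclideanSpace ℝ (Fin d), (∀ b, ‖y b‖ = r) ∧
      ∀ M ⊆ T, ∀ b ∈ T, M.card ≤ d → b ∉ M → y b ∉ affineSpan ℝ (y '' M) by
    obtain ⟨y, h1, h2⟩ := H Finset.univ
    exact ⟨y, h1, fun M b => h2 M (Finset.subset_univ _) b (Finset.mem_univ _)⟩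
  intro T
  induction T using Finset.induction_on with
  | empty =>
    refine ⟨fun _ => EuclideanSpace.single ⟨0, by omega⟩ r, fun _ => ?_, by simp⟩
    rw [PiLp.norm_single, Real.norm_eq_abs, abs_of_pos hr]
  | insert b₀ T hb₀ ih =>
    obtain ⟨y, hy, hgp⟩ := ih
    have hyp : ∀ M : Finset B, ∃ q : EuclideanSpace ℝ (Fin d) × ℝ, M.card ≤ d →
        q.1 ≠ 0 ∧ ∀ p ∈ affineSpan ℝ (y '' M), inner ℝ p q.1 = q.2 := by
      intro M
      by_cases hM : M.card ≤ d
      · obtain ⟨u, κ, hu, h⟩ := exists_hyperplane_of_card_le (by omega) (M.image y)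
          (Finset.card_image_le.trans hM)
        exact ⟨(u, κ), fun _ => ⟨hu, by simpa using h⟩⟩
      · exact ⟨0, fun h => absurd h hM⟩
    choose q hq using hyp
    obtain ⟨w, -, hw1, hw⟩ := exists_unit_inner_ne (⊤ : Submodule ℝ (EuclideanSpace ℝ (Fin d)))
      (by simpa using hd)
      ((T.powerset.filter fun M => M.card ≤ d).image fun M => ((q M).1, (q M).2 / r)) (by
        intro p hp
        obtain ⟨M, hM, rfl⟩ := Finset.mem_image.1 hp
        simpa using (hq M (Finset.mem_filter.1 hM).2).1)
    -- the new point avoids all hyperplanes spanned by old points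
    have hnew : ∀ M ⊆ T, M.card ≤ d → r • w ∉ affineSpan ℝ (y '' M) := by
      intro M hM hMd hmem
      refine hw _ (Finset.mem_image_of_mem _
        (Finset.mem_filter.2 ⟨Finset.mem_powerset.2 hM, hMd⟩)) ?_
      have := (hq M hMd).2 _ hmem
      rw [real_inner_smul_left] at this
      rw [eq_div_iff hr.ne', mul_comm]
      exact this
    have himg : ∀ M : Finset B, b₀ ∉ M → Function.update y b₀ (r • w) '' M = y '' M := by
      intro M hM
      refine Set.image_congr fun b hb => Function.update_of_ne ?_ _ _
      rintro rfl
      exact hM hb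
    refine ⟨Function.update y b₀ (r • w), fun b => ?_, fun M hM b hb hMd hbM => ?_⟩
    · by_cases hb : b = b₀
      · rw [hb, Function.update_self, norm_smul, hw1, mul_one, Real.norm_eq_abs, abs_of_pos hr]
      · rw [Function.update_of_ne hb]
        exact hy b
    · by_cases hbb : b = b₀
      · subst hbb
        rw [himg M hbM, Function.update_self]
        exact hnew M ((Finset.subset_insert_iff_of_notMem hbM).1 hM) hMd
      have hbT : b ∈ T := (Finset.mem_insert.1 hb).resolve_left hbb
      rw [Function.update_of_ne hbb]
      by_cases hbM0 : b₀ ∈ M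
      · -- exchange the new point for `b`
        set M' := M.erase b₀ with hM'
        have hM'T : M' ⊆ T := fun b hb => (Finset.mem_insert.1 (hM (Finset.mem_of_mem_erase hb))
          ).resolve_left (Finset.ne_of_mem_erase hb)
        have hcard : M'.card + 1 = M.card := Finset.card_erase_add_one hbM0
        have hbM' : b ∉ M' := fun h => hbM (Finset.mem_of_mem_erase h)
        have hMe : Function.update y b₀ (r • w) '' M = insert (r • w) (y '' M') := by
          rw [← Finset.insert_erase hbM0, Finset.coe_insert, Set.image_insert_eq,
            Function.update_self, himg _ (Finset.notMem_erase _ _)]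
        rw [hMe]
        intro hmem
        have := mem_affineSpan_insert_exchange hmem (hgp M' hM'T b hbT (by omega) hbM')
        rw [← Set.image_insert_eq, ← Finset.coe_insert] at this
        refine hnew _ ?_ ?_ this
        · exact Finset.insert_subset hbT hM'T
        · rw [Finset.card_insert_of_notMem hbM']
          omega
      · rw [himg M hbM0]
        exact hgp M ((Finset.subset_insert_iff_of_notMem hbM0).1 hM) b hbT hMd hbM

end GeneralPosition

/-! ### Spherical representations -/

open Filter Topology

/-- The bipartite graph with neighbourhoods `N`, restricted to the set `S` of vertices in `A`, is a
faithful distance graph in `ℝ^d` for some distance `√ρ`, with the whole class `B` on a sphere of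
radius `√σ < √ρ / 2` about `0` and with the points of `S` outside that sphere. -/
def HasSphericalRep (d : ℕ) {A B : Type*} (N : A → Finset B) (S : Finset A) : Prop :=
  ∃ (ρ σ : ℝ) (x : A → EuclideanSpace ℝ (Fin d)) (y : B → EuclideanSpace ℝ (Fin d)),
    0 < σ ∧ 4 * σ < ρ ∧ Function.Injective y ∧ (∀ b, ‖y b‖ ^ 2 = σ) ∧ (∀ a ∈ S, σ < ‖x a‖ ^ 2) ∧
    (∀ a ∈ S, ∀ b, ‖x a - y b‖ ^ 2 = ρ ↔ b ∈ N a) ∧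
    ∀ a ∈ S, ∀ a' ∈ S, a ≠ a' → x a ≠ x a' ∧ ‖x a - x a'‖ ^ 2 ≠ ρ

section FewNeighbours

variable {d : ℕ} {A B : Type*} {r : ℝ} {N : A → Finset B} {y : B → EuclideanSpace ℝ (Fin d)}
  {S : Finset A} {x : A → EuclideanSpace ℝ (Fin d)}

theorem IsPlacement.hasSphericalRep (h : IsPlacement r N y S x) (hr0 : 0 < r) (hr : r < 1 / 2)
    (hy : ∀ b, ‖y b‖ = r) (hinj : Function.Injective y) : HasSphericalRep d N S :=
  ⟨1, r ^ 2, x, y, by positivity, by nlinarith, hinj, fun b => by rw [hy],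
    fun a ha => by have := h.far a ha; gcongr, h.adj, h.sep⟩

theorem vsub_mem_vectorSpan_image_iff
    (hgp : ∀ (M : Finset B) (b : B), M.card ≤ d → b ∉ M → y b ∉ affineSpan ℝ (y '' M))
    {M : Finset B} (hM : M.card ≤ d) {b₁ : B} (hb₁ : b₁ ∈ M) (b : B) :
    y b - y b₁ ∈ vectorSpan ℝ (y '' M) ↔ b ∈ M := by
  rw [← direction_affineSpan, ← vsub_eq_sub, AffineSubspace.vsub_right_mem_direction_iff_mem
    (mem_affineSpan ℝ (Set.mem_image_of_mem y hb₁))]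
  refine ⟨fun h => ?_, fun h => mem_affineSpan ℝ (Set.mem_image_of_mem y h)⟩
  by_contra hb
  exact hgp M b hM hb h

theorem isCutOutByFlat_of_generalPosition (hd : 2 ≤ d) (hr : 0 < r) (hy : ∀ b, ‖y b‖ = r)
    (hgp : ∀ (M : Finset B) (b : B), M.card ≤ d → b ∉ M → y b ∉ affineSpan ℝ (y '' M))
    {M : Finset B} (hM : M.card < d) : IsCutOutByFlat r y M := by
  classical
  rcases M.eq_empty_or_nonempty with rfl | ⟨b₁, hb₁⟩
  · refine ⟨0, ⊥, by simpa using hr.le, by simpa using hd, fun b => ?_⟩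
    have : y b ≠ 0 := by
      intro h
      have := hy b
      rw [h, norm_zero] at this
      exact hr.ne this
    simpa using this
  · have hpos : 0 < M.card := Finset.card_pos.2 ⟨b₁, hb₁⟩
    refine ⟨y b₁, vectorSpan ℝ (y '' M), (hy b₁).le, ?_,
      vsub_mem_vectorSpan_image_iff hgp hM.le hb₁⟩
    have := finrank_vectorSpan_image_finset_le ℝ y M (n := M.card - 1) (by omega)
    rw [Finset.coe_image] at this
    omega

/-- For at most `d` points in general position on a small sphere about `0` there are two points at
distance `1` from exactly these, on opposite sides of `0`; so one of them lies in any given closed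
half-space bounded by a hyperplane through `0`. -/
theorem exists_point_of_card_le [Fintype B] (hr : r ≤ 1 / 4) (hy : ∀ b, ‖y b‖ = r)
    (hgp : ∀ (M : Finset B) (b : B), M.card ≤ d → b ∉ M → y b ∉ affineSpan ℝ (y '' M))
    {M : Finset B} (hM : M.card ≤ d) (hM0 : M.Nonempty) (z : EuclideanSpace ℝ (Fin d)) :
    ∃ p, 1 - r ≤ ‖p‖ ∧ (∀ b, ‖p - y b‖ ^ 2 = 1 ↔ b ∈ M) ∧ inner ℝ p z ≤ 0 := by
  classical
  obtain ⟨b₁, hb₁⟩ := hM0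
  have hr0 : 0 ≤ r := hy b₁ ▸ norm_nonneg _
  have hpos : 0 < M.card := Finset.card_pos.2 ⟨b₁, hb₁⟩
  set V := vectorSpan ℝ (y '' M) with hV
  have hfin := finrank_vectorSpan_image_finset_le ℝ y M (n := M.card - 1) (by omega)
  rw [Finset.coe_image, ← hV] at hfin
  have hadd := V.finrank_add_finrank_orthogonal
  rw [finrank_euclideanSpace_fin] at hadd
  obtain ⟨n, hn, hn1, hnF⟩ := exists_unit_inner_ne_zero Vᗮ (by
      intro h
      rw [h] at hadd
      simp at hadd
      omega)
    ((Finset.univ.filter fun b => b ∉ M).image fun b => y b - y b₁) (by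
      intro u hu
      obtain ⟨b, hb, rfl⟩ := Finset.mem_image.1 hu
      rw [Submodule.orthogonal_orthogonal, hV, vsub_mem_vectorSpan_image_iff hgp hM hb₁]
      exact (Finset.mem_filter.1 hb).2)
  -- the points of `M` are those on the hyperplane `⟪n, ·⟫ = κ`
  set κ := inner ℝ n (y b₁) with hκ
  have hnκ : ∀ b, inner ℝ n (y b) = κ ↔ b ∈ M := by
    intro b
    have hsub : inner ℝ n (y b - y b₁) = inner ℝ n (y b) - κ := inner_sub_right _ _ _
    constructor
    · intro h
      by_contra hb
      exact hnF _ (Finset.mem_image_of_mem _ (Finset.mem_filter.2 ⟨Finset.mem_univ b, hb⟩))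
        (by rw [hsub, h, sub_self])
    · intro hb
      have := hn _ ((vsub_mem_vectorSpan_image_iff hgp hM hb₁ b).2 hb)
      rw [real_inner_comm, hsub] at this
      linarith
  have hκr : |κ| ≤ r := by
    have := abs_real_inner_le_norm n (y b₁)
    rwa [hn1, hy, one_mul] at this
  obtain ⟨hκ1, hκ2⟩ := abs_le.1 hκr
  set s := Real.sqrt (κ ^ 2 + 1 - r ^ 2) with hs
  have hs2 : s ^ 2 = κ ^ 2 + 1 - r ^ 2 := Real.sq_sqrt (by nlinarith [sq_nonneg κ])
  have hs0 : 0 ≤ s := Real.sqrt_nonneg _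
  -- the two roots of `t ^ 2 - 2 * t * κ + r ^ 2 = 1`
  have hroot : ∀ t : ℝ, (t - κ) ^ 2 = s ^ 2 → 1 - r ≤ |t| →
      1 - r ≤ ‖t • n‖ ∧ ∀ b, ‖t • n - y b‖ ^ 2 = 1 ↔ b ∈ M := by
    intro t ht htr
    have ht0 : t ≠ 0 := by
      rintro rfl
      rw [abs_zero] at htr
      linarith
    refine ⟨by rwa [norm_smul, hn1, mul_one], fun b => ?_⟩
    rw [norm_sub_sq_real, norm_smul, hn1, hy, real_inner_smul_left, Real.norm_eq_abs, mul_one,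
      sq_abs, ← hnκ]
    constructor
    · intro h
      have : 2 * t * (inner ℝ n (y b) - κ) = 0 := by nlinarith
      rcases mul_eq_zero.1 this with h | h
      · exact absurd h (by simpa using ht0)
      · linarith
    · intro h
      rw [h]
      nlinarith
  have hsκ : 1 - r ≤ s - |κ| := by
    have h0 := abs_nonneg κ
    have h1 : |κ| ^ 2 = κ ^ 2 := sq_abs κ
    have h2 : s ≤ 1 := by nlinarith
    nlinarith
  have hsle := neg_abs_le κ
  have hsle' := le_abs_self κ
  rcases le_total (inner ℝ n z) 0 with hz | hz
  · obtain ⟨h1, h2⟩ := hroot (κ + s) (by ring) ((by linarith : 1 - r ≤ κ + s).trans (le_abs_self _))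
    refine ⟨_, h1, h2, ?_⟩
    rw [real_inner_smul_left]
    exact mul_nonpos_of_nonneg_of_nonpos (by linarith) hz
  · obtain ⟨h1, h2⟩ := hroot (κ - s) (by ring)
      ((by linarith : 1 - r ≤ -(κ - s)).trans (neg_le_abs _))
    refine ⟨_, h1, h2, ?_⟩
    rw [real_inner_smul_left]
    exact mul_nonpos_of_nonpos_of_nonneg (by linarith) hz

/-- The generic case: `B` is put in general position. A vertex with fewer than `d` neighbours then
has a sphere of positive dimension to move on; for a vertex with `d` neighbours there are only two
points to choose from, which is enough for two such vertices. -/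
theorem hasSphericalRep_of_card_le (hd : 2 ≤ d) [Fintype B] (hS : ∀ a ∈ S, (N a).card ≤ d)
    (hS2 : (S.filter fun a => d ≤ (N a).card).card ≤ 2) : HasSphericalRep d N S := by
  classical
  obtain ⟨y, hy, hgp⟩ := exists_generalPosition_on_sphere hd (B := B) (r := 1 / 4) (by norm_num)
  have hinj : Function.Injective y := by
    intro b b' h
    by_contra hne
    apply hgp {b'} b (by rw [Finset.card_singleton]; omega) (by simpa using hne)
    rw [h]
    exact mem_affineSpan ℝ (by simp)
  set H := S.filter fun a => d ≤ (N a).card with hH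
  have hpt : ∀ a ∈ H, ∀ z : EuclideanSpace ℝ (Fin d), ∃ p, 1 - 1 / 4 ≤ ‖p‖ ∧
      (∀ b, ‖p - y b‖ ^ 2 = 1 ↔ b ∈ N a) ∧ inner ℝ p z ≤ 0 := by
    intro a ha z
    have ha' := Finset.mem_filter.1 ha
    exact exists_point_of_card_le le_rfl hy hgp (hS a ha'.1)
      (Finset.card_pos.1 (by omega)) z
  have h0 : IsPlacement (1 / 4) N y ∅ (0 : A → EuclideanSpace ℝ (Fin d)) :=
    ⟨by simp, by simp, by simp⟩
  obtain ⟨x, hx⟩ : ∃ x, IsPlacement (1 / 4) N y H x := by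
    have hcases : H.card = 0 ∨ H.card = 1 ∨ H.card = 2 := by omega
    rcases hcases with h | h | h
    · rw [Finset.card_eq_zero.1 h]
      exact ⟨_, h0⟩
    · obtain ⟨a, ha⟩ := Finset.card_eq_one.1 h
      obtain ⟨p, hp, hpa, -⟩ := hpt a (by simp [ha]) 0
      rw [ha]
      exact ⟨_, h0.insert_point (a := a) (by simp) (by linarith) hpa (by simp)⟩
    · obtain ⟨a, a', hne, ha⟩ := Finset.card_eq_two.1 h
      obtain ⟨p, hp, hpa, -⟩ := hpt a' (by simp [ha]) 0
      obtain ⟨q, hq, hqa, hqp⟩ := hpt a (by simp [ha]) p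
      rw [ha]
      refine ⟨_, (h0.insert_point (a := a') (by simp) (by linarith) hpa (by simp)).insert_point
        (a := a) (by simpa using hne) (by linarith) hqa (fun c hc => ?_)⟩
      obtain rfl : c = a' := by simpa using hc
      rw [Function.update_self]
      have : 1 < ‖q - p‖ ^ 2 := by
        rw [norm_sub_sq_real]
        nlinarith
      refine ⟨?_, this.ne'⟩
      rintro rfl
      simp at this
      linarith
  obtain ⟨x', hx'⟩ := hx.exists_extension (by norm_num) hy S (fun a ha haH =>
    isCutOutByFlat_of_generalPosition hd (by norm_num) hy hgp (by
      by_contra hcon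
      exact haH (Finset.mem_filter.2 ⟨ha, by omega⟩)))
  rw [Finset.union_eq_right.2 (Finset.filter_subset _ _)] at hx'
  exact hx'.hasSphericalRep (by norm_num) (by norm_num) hy hinj

end FewNeighbours

section AddingADimension

/-- The point of `ℝ^(d+1)` at height `h` above the point `p` of `ℝ^d`; the height is the first
coordinate. -/
noncomputable def atHeight {d : ℕ} (h : ℝ) (p : EuclideanSpace ℝ (Fin d)) :
    EuclideanSpace ℝ (Fin (d + 1)) :=
  WithLp.toLp 2 (Fin.cons h p.ofLp : Fin (d + 1) → ℝ)

theorem norm_atHeight_sq {d : ℕ} (h : ℝ) (p : EuclideanSpace ℝ (Fin d)) :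
    ‖atHeight h p‖ ^ 2 = h ^ 2 + ‖p‖ ^ 2 := by
  simp [atHeight, EuclideanSpace.norm_sq_eq, Fin.sum_univ_succ]

theorem atHeight_sub {d : ℕ} (h k : ℝ) (p q : EuclideanSpace ℝ (Fin d)) :
    atHeight h p - atHeight k q = atHeight (h - k) (p - q) := by
  ext i
  refine Fin.cases ?_ (fun i => ?_) i <;> simp [atHeight]

theorem atHeight_inj {d : ℕ} {h k : ℝ} {p q : EuclideanSpace ℝ (Fin d)} :
    atHeight h p = atHeight k q ↔ h = k ∧ p = q := by
  rw [atHeight, atHeight, (WithLp.toLp_injective 2).eq_iff, Fin.cons_inj]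
  exact and_congr_right fun _ => (WithLp.ofLp_injective 2).eq_iff

/-- One more dimension makes room for one more vertex `v`, whatever its neighbourhood: the points of
`B` are lifted to height `-h` or `h` according as they are adjacent to `v` or not, the points of `S`
stay at height `0`, and `v` goes on the new axis, at the right distance from all points of the old
sphere at height `-h`. -/
theorem HasSphericalRep.insert_vertex {d : ℕ} {A B : Type*} [DecidableEq A] {N : A → Finset B}
    {S : Finset A} (hS : HasSphericalRep d N S) (v : A) :
    HasSphericalRep (d + 1) N (insert v S) := by
  classical
  obtain ⟨ρ, σ, x, y, hσ, hρ, hinj, hy, hfar, hadj, hsep⟩ := hS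
  have hpos : ∀ f : ℝ → ℝ, Continuous f → 0 < f 0 → ∀ᶠ h in 𝓝[>] (0 : ℝ), 0 < f h :=
    fun f hf h0 => nhdsWithin_le_nhds (hf.continuousAt.eventually_const_lt h0)
  have hne : ∀ f : ℝ → ℝ, Continuous f → f 0 ≠ 0 → ∀ᶠ h in 𝓝[>] (0 : ℝ), f h ≠ 0 :=
    fun f hf h0 => nhdsWithin_le_nhds (hf.continuousAt.eventually_ne h0)
  have hsq : √(ρ - σ) ^ 2 = ρ - σ := Real.sq_sqrt (by linarith)
  have ev : ∀ᶠ h in 𝓝[>] (0 : ℝ), 0 < h ∧ 0 < (ρ + h ^ 2) - 4 * (σ + h ^ 2) ∧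
      0 < √(ρ + h ^ 2 - σ) - h ∧ 0 < (√(ρ + h ^ 2 - σ) - h) ^ 2 - (σ + h ^ 2) ∧
      (∀ a ∈ S, 0 < ‖x a‖ ^ 2 - (σ + h ^ 2)) ∧
      (∀ a ∈ S, ‖x a‖ ^ 2 + (√(ρ + h ^ 2 - σ) - h) ^ 2 - (ρ + h ^ 2) ≠ 0) ∧
      ∀ a ∈ S, ∀ a' ∈ S, a ≠ a' → ‖x a - x a'‖ ^ 2 - (ρ + h ^ 2) ≠ 0 := by
    refine eventually_mem_nhdsWithin.and ((hpos _ (by fun_prop) ?_).and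
      ((hpos _ (by fun_prop) ?_).and ((hpos _ (by fun_prop) ?_).and (((Finset.eventually_all S).2 fun a ha =>
        hpos _ (by fun_prop) ?_).and (((Finset.eventually_all S).2 fun a ha =>
        hne _ (by fun_prop) ?_).and ((Finset.eventually_all S).2 fun a ha =>
        (Finset.eventually_all S).2 fun a' ha' => eventually_imp_distrib_left.2 fun haa' =>
        hne _ (by fun_prop) ?_))))))
    · simpa using hρ
    · have : 0 < √(ρ - σ) := Real.sqrt_pos.2 (by linarith)
      simpa using this
    · simp [hsq]
      linarith
    · simpa using hfar a ha
    · have := hfar a ha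
      simp [hsq]
      intro h
      linarith
    · simpa [sub_eq_zero] using (hsep a ha a' ha' haa').2
  obtain ⟨h, h0, h1, h2, h3, h4, h5, h6⟩ := ev.exists
  set t := √(ρ + h ^ 2 - σ) - h with ht
  have hth : (t + h) ^ 2 = ρ + h ^ 2 - σ := by
    rw [ht, sub_add_cancel]
    exact Real.sq_sqrt (by nlinarith)
  let x' : A → EuclideanSpace ℝ (Fin (d + 1)) := fun a =>
    if a = v then atHeight t 0 else atHeight 0 (x a)
  let y' : B → EuclideanSpace ℝ (Fin (d + 1)) := fun b =>
    atHeight (if b ∈ N v then -h else h) (y b)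
  have hh : ∀ b, (if b ∈ N v then -h else h) ^ 2 = h ^ 2 := by
    intro b
    split_ifs <;> ring
  have hxv : x' v = atHeight t 0 := if_pos rfl
  have hx : ∀ a, a ≠ v → x' a = atHeight 0 (x a) := fun a ha => if_neg ha
  have hmem : ∀ a ∈ insert v S, a ≠ v → a ∈ S :=
    fun a ha hav => Finset.mem_of_mem_insert_of_ne ha hav
  have hsepv : ∀ a ∈ S, a ≠ v → x' v ≠ x' a ∧ ‖x' v - x' a‖ ^ 2 ≠ ρ + h ^ 2 := by
    intro a ha hav
    rw [hxv, hx a hav, atHeight_sub, norm_atHeight_sq, Ne, atHeight_inj]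
    refine ⟨fun e => h2.ne' e.1, fun e => h5 a ha ?_⟩
    rw [zero_sub, norm_neg, sub_zero] at e
    linarith
  refine ⟨ρ + h ^ 2, σ + h ^ 2, x', y', by positivity, by linarith, fun b b' e => ?_, fun b => ?_,
    fun a ha => ?_, fun a ha b => ?_, fun a ha a' ha' haa' => ?_⟩
  · exact hinj (atHeight_inj.1 e).2
  · rw [norm_atHeight_sq, hh, hy, add_comm]
  · by_cases hav : a = v
    · rw [hav, hxv, norm_atHeight_sq]
      simp
      linarith
    · rw [hx a hav, norm_atHeight_sq]
      have := h4 a (hmem a ha hav)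
      linarith
  · by_cases hav : a = v
    · rw [hav, hxv, atHeight_sub, norm_atHeight_sq, zero_sub, norm_neg, hy]
      by_cases hb : b ∈ N v
      · simp only [hb, if_true, iff_true]
        linarith
      · simp only [hb, if_false, iff_false]
        intro e
        have h0' : 0 < h := h0
        have := mul_pos h2 h0'
        linarith
    · rw [hx a hav, atHeight_sub, norm_atHeight_sq, zero_sub, neg_sq, hh,
        ← hadj a (hmem a ha hav)]
      constructor <;> intro e <;> linarith
  · by_cases hav : a = v
    · subst hav
      exact hsepv a' (hmem a' ha' (Ne.symm haa')) (Ne.symm haa')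
    · by_cases hav' : a' = v
      · subst hav'
        rw [norm_sub_rev, ne_comm]
        exact hsepv a (hmem a ha haa') haa'
      · have hs := hsep a (hmem a ha hav) a' (hmem a' ha' hav') haa'
        rw [hx a hav, hx a' hav', atHeight_sub, norm_atHeight_sq, Ne, atHeight_inj]
        refine ⟨fun e => hs.1 e.2, fun e => h6 a (hmem a ha hav) a' (hmem a' ha' hav') haa' ?_⟩
        linarith

end AddingADimension

/-! ### Few edges -/

section FewEdges

variable {A B : Type*} [DecidableEq A] {N : A → Finset B} {S : Finset A} {d : ℕ}

/-- Almost all edges at `S` are concentrated on few vertices: either fewer than `d` vertices carry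
all edges but at most two, or at most `d` vertices, three of them of degree at most three, carry
all edges. This is how the removal of vertices of large degree can fail. -/
def IsConcentrated (d : ℕ) (N : A → Finset B) (S : Finset A) : Prop :=
  (∃ W ⊆ S, W.card + 1 ≤ d ∧ ∑ a ∈ S \ W, (N a).card ≤ 2) ∨
    ∃ W ⊆ S, W.card ≤ d ∧ ∑ a ∈ S \ W, (N a).card = 0 ∧
      ∃ T ⊆ W, T.card = 3 ∧ ∀ a ∈ T, (N a).card ≤ 3

theorem IsConcentrated.of_erase {v : A} (h : IsConcentrated d N (S.erase v)) (hv : v ∈ S) :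
    IsConcentrated (d + 1) N S := by
  have hsub : ∀ W ⊆ S.erase v, insert v W ⊆ S := fun W hW =>
    Finset.insert_subset hv (hW.trans (Finset.erase_subset _ _))
  have hsd : ∀ W : Finset A, S \ insert v W = S.erase v \ W := fun W => by
    ext a
    simp
    tauto
  rcases h with ⟨W, hW, hc, hs⟩ | ⟨W, hW, hc, hs, T, hT, hT3⟩
  · refine Or.inl ⟨insert v W, hsub W hW, ?_, by rwa [hsd]⟩
    have := Finset.card_insert_le v W
    omega
  · refine Or.inr ⟨insert v W, hsub W hW, ?_, by rwa [hsd], T,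
      hT.trans (Finset.subset_insert _ _), hT3⟩
    have := Finset.card_insert_le v W
    omega

theorem choose_two_succ (n : ℕ) : (n + 1).choose 2 = n.choose 2 + n := by
  rw [Nat.choose_succ_succ' n 1, Nat.choose_one_right, add_comm]

/-- Removing a vertex of degree more than `d`, or three vertices of degree `d`, costs as many
dimensions as vertices, and at least the number of edges by which the bound `(d + 2).choose 2`
drops. What remains in the end is either generic or concentrated. -/
theorem hasSphericalRep_or_isConcentrated [Fintype B] (hd : 2 ≤ d)
    (hS : ∑ a ∈ S, (N a).card < (d + 2).choose 2) :
    HasSphericalRep d N S ∨ IsConcentrated d N S := by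
  induction d using Nat.strong_induction_on generalizing S with
  | _ d ih =>
  by_cases h1 : ∃ v ∈ S, d < (N v).card
  · obtain ⟨v, hv, hdv⟩ := h1
    obtain ⟨m, rfl⟩ : ∃ m, d = m + 1 := ⟨d - 1, by omega⟩
    have hsum := Finset.add_sum_erase S (fun a => (N a).card) hv
    have hch := choose_two_succ (m + 2)
    simp only [show m + 1 + 2 = m + 2 + 1 by ring] at hS
    have hlt : ∑ a ∈ S.erase v, (N a).card < (m + 2).choose 2 := by
      omega
    rcases Nat.lt_or_ge m 2 with hm | hm
    · obtain rfl : m = 1 := by omega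
      refine Or.inr (Or.inl ⟨{v}, by simpa using hv, by simp, ?_⟩)
      rw [Finset.sdiff_singleton_eq_erase]
      simp [Nat.choose] at hlt
      omega
    · rcases ih m (by omega) hm hlt with h | h
      · left
        have := h.insert_vertex v
        rwa [Finset.insert_erase hv] at this
      · exact Or.inr (h.of_erase hv)
  by_cases h2 : 2 < (S.filter fun a => d ≤ (N a).card).card
  · obtain ⟨a, b, c, ha, hb, hc, hab, hac, hbc⟩ := Finset.two_lt_card_iff.1 h2
    rw [Finset.mem_filter] at ha hb hc
    have hb1 : b ∈ S.erase a := Finset.mem_erase.2 ⟨hab.symm, hb.1⟩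
    have hc1 : c ∈ (S.erase a).erase b :=
      Finset.mem_erase.2 ⟨hbc.symm, Finset.mem_erase.2 ⟨hac.symm, hc.1⟩⟩
    have e1 := Finset.add_sum_erase S (fun a => (N a).card) ha.1
    have e2 := Finset.add_sum_erase _ (fun a => (N a).card) hb1
    have e3 := Finset.add_sum_erase _ (fun a => (N a).card) hc1
    have hW : ({a, b, c} : Finset A) ⊆ S := by
      intro z hz
      simp at hz
      rcases hz with rfl | rfl | rfl
      exacts [ha.1, hb.1, hc.1]
    have hWc : ({a, b, c} : Finset A).card = 3 :=
      Finset.card_eq_three.2 ⟨a, b, c, hab, hac, hbc, rfl⟩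
    have hSW : S \ {a, b, c} = ((S.erase a).erase b).erase c := by
      ext z
      simp
      tauto
    have hcases : d = 2 ∨ d = 3 ∨ d = 4 ∨ 5 ≤ d := by omega
    rcases hcases with rfl | rfl | rfl | hd5
    · simp [Nat.choose] at hS
      omega
    · simp [Nat.choose] at hS
      refine Or.inr (Or.inr ⟨{a, b, c}, hW, hWc.le, ?_, {a, b, c}, subset_rfl, hWc, ?_⟩)
      · rw [hSW]
        omega
      · intro z hz
        simp at hz
        rcases hz with rfl | rfl | rfl <;> omega
    · simp [Nat.choose] at hS
      refine Or.inr (Or.inl ⟨{a, b, c}, hW, by omega, ?_⟩)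
      rw [hSW]
      omega
    · obtain ⟨m, rfl⟩ : ∃ m, d = m + 3 := ⟨d - 3, by omega⟩
      have c1 := choose_two_succ (m + 2)
      have c2 := choose_two_succ (m + 3)
      have c3 := choose_two_succ (m + 4)
      simp only [show m + 3 + 2 = m + 4 + 1 by ring] at hS
      simp only [show m + 2 + 1 = m + 3 by ring, show m + 3 + 1 = m + 4 by ring] at c1 c2
      rcases ih m (by omega) (by omega) (S := ((S.erase a).erase b).erase c) (by omega) with h | h
      · left
        have := ((h.insert_vertex c).insert_vertex b).insert_vertex a
        rwa [Finset.insert_erase hc1, Finset.insert_erase hb1, Finset.insert_erase ha.1] at this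
      · exact Or.inr (((h.of_erase hc1).of_erase hb1).of_erase ha.1)
  · push Not at h1
    exact Or.inl (hasSphericalRep_of_card_le hd h1 (by omega))

end FewEdges

section CoplanarQuadruple

/-- Here the class on the sphere has exactly `d` vertices, and every vertex of the other class is
adjacent to all of them or to none of three exceptional ones. The `d` points are then put on a
sphere of dimension only `d - 3`, with one affine dependence, which is among the three exceptional
points and a fourth one. -/
theorem hasSphericalRep_of_card_eq {A B : Type*} [Fintype A] {d : ℕ} (hd : 4 ≤ d)
    (hA : Fintype.card A = d) {N : B → Finset A} (S : Finset B) (T : Finset A) (hT : T.card = 3)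
    (h : ∀ b, N b = Finset.univ ∨ Disjoint (N b) T) : HasSphericalRep d N S := by
  classical
  obtain ⟨a₁, a₂, a₃, h12, h13, h23, rfl⟩ := Finset.card_eq_three.1 hT
  obtain ⟨a₄, ha₄⟩ : ∃ a₄, a₄ ∉ ({a₁, a₂, a₃} : Finset A) := by
    by_contra hcon
    push Not at hcon
    have := Finset.card_le_card (fun a _ => hcon a : (Finset.univ : Finset A) ⊆ {a₁, a₂, a₃})
    rw [Finset.card_univ, hA] at this
    omega
  simp only [Finset.mem_insert, Finset.mem_singleton, not_or] at ha₄
  obtain ⟨h14, h24, h34⟩ := ha₄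
  let e : A ≃ Fin d := Fintype.equivFinOfCardEq hA
  let ε : A → EuclideanSpace ℝ (Fin d) := fun a => EuclideanSpace.single (e a) 1
  have hε : ∀ a a', ε a (e a') = if a' = a then 1 else 0 := by
    intro a a'
    simp [ε, e.injective.eq_iff]
  -- `(2/3, 2/3, -1/3)` is a unit vector with coordinate sum `1`
  let u : A → EuclideanSpace ℝ (Fin d) := fun a =>
    if a = a₁ then (2 / 3 : ℝ) • ε a₂ + (2 / 3 : ℝ) • ε a₃ - (1 / 3 : ℝ) • ε a₄ else ε a
  have hu1 : u a₁ = (2 / 3 : ℝ) • ε a₂ + (2 / 3 : ℝ) • ε a₃ - (1 / 3 : ℝ) • ε a₄ := if_pos rfl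
  have hu : ∀ a, a ≠ a₁ → u a = ε a := fun a ha => if_neg ha
  have hin : ∀ a a', inner ℝ (ε a) (ε a') = if a = a' then (1 : ℝ) else 0 := by
    intro a a'
    simp only [ε, EuclideanSpace.inner_single_left, map_one, one_mul]
    exact hε a' a
  have hnorm : ∀ a, ‖u a‖ ^ 2 = 1 := by
    intro a
    rw [← real_inner_self_eq_norm_sq]
    by_cases ha : a = a₁
    · rw [ha, hu1]
      simp only [inner_add_left, inner_sub_left, inner_add_right, inner_sub_right,
        real_inner_smul_left, real_inner_smul_right, hin, h23, h24, h34, h23.symm, Ne.symm h24,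
        Ne.symm h34, if_true, if_false]
      norm_num
    · rw [hu a ha, hin, if_pos rfl]
  have hunorm : ∀ a, ‖u a‖ = 1 := fun a => by
    exact (pow_eq_one_iff_of_nonneg (norm_nonneg _) two_ne_zero).1 (hnorm a)
  -- a coordinate that is nonzero at `u a`
  let i : A → Fin d := fun a => if a = a₁ then e a₂ else e a
  have hi1 : i a₁ = e a₂ := if_pos rfl
  have hi : ∀ a, a ≠ a₁ → i a = e a := fun a ha => if_neg ha
  have hcoord : ∀ a, u a (i a) ≠ 0 := by
    intro a
    by_cases ha : a = a₁
    · rw [ha, hu1, hi1]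
      simp [hε, h23, Ne.symm h24]
    · rw [hu a ha, hi a ha, hε]
      simp
  have hinj : Function.Injective u := by
    have h1 : ∀ a, a ≠ a₁ → u a₁ ≠ u a := by
      intro a ha heq
      have := congrArg (fun p : EuclideanSpace ℝ (Fin d) => p (e a₂)) heq
      simp only [hu1, hu a ha] at this
      simp only [PiLp.sub_apply, PiLp.add_apply, PiLp.smul_apply, hε, h23, Ne.symm h24, if_true,
        if_false, smul_eq_mul] at this
      split_ifs at this <;> norm_num at this
    intro a a' heq
    by_cases ha : a = a₁ <;> by_cases ha' : a' = a₁
    · rw [ha, ha']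
    · rw [ha] at heq
      exact absurd heq (h1 a' ha')
    · rw [ha'] at heq
      exact absurd heq.symm (h1 a ha)
    · rw [hu a ha, hu a' ha'] at heq
      have := congrArg (fun p : EuclideanSpace ℝ (Fin d) => p (e a)) heq
      simp only [hε] at this
      by_contra hne
      simp [hne] at this
  let y : A → EuclideanSpace ℝ (Fin d) := fun a => (1 / 4 : ℝ) • u a
  have hy : ∀ a, ‖y a‖ = 1 / 4 := by
    intro a
    simp only [y]
    rw [norm_smul, hunorm, mul_one, Real.norm_eq_abs]
    norm_num
  have hyinj : Function.Injective y := fun a a' h => hinj (smul_right_injective _ (by norm_num) h)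
  have hempty : IsPlacement (1 / 4) N y ∅ (0 : B → EuclideanSpace ℝ (Fin d)) :=
    ⟨by simp, by simp, by simp⟩
  obtain ⟨x, hx⟩ := hempty.exists_extension (by norm_num) hy S (fun b _ _ => by
    rcases h b with hb | hb
    · refine ⟨y a₂, Submodule.span ℝ (((Finset.univ \ {a₁, a₂}).image fun a => y a - y a₂ :
        Finset (EuclideanSpace ℝ (Fin d))) : Set (EuclideanSpace ℝ (Fin d))), (hy a₂).le, ?_, ?_⟩
      · have h1 := finrank_span_finset_le_card (R := ℝ)
          ((Finset.univ \ {a₁, a₂}).image fun a => y a - y a₂)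
        rw [Set.finrank] at h1
        have h2 := Finset.card_image_le (s := Finset.univ \ {a₁, a₂}) (f := fun a => y a - y a₂)
        have h3 : (Finset.univ \ {a₁, a₂} : Finset A).card + 2 = d := by
          rw [Finset.card_sdiff_of_subset (Finset.subset_univ _), Finset.card_pair h12,
            Finset.card_univ, hA]
          omega
        omega
      · have hmem : ∀ a, a ≠ a₁ → y a - y a₂ ∈ Submodule.span ℝ
            (((Finset.univ \ {a₁, a₂}).image fun a => y a - y a₂ :
            Finset (EuclideanSpace ℝ (Fin d))) : Set (EuclideanSpace ℝ (Fin d))) := by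
          intro a ha
          by_cases ha2 : a = a₂
          · rw [ha2, sub_self]
            exact Submodule.zero_mem _
          · exact Submodule.subset_span (Finset.mem_image_of_mem _ (by simp [ha, ha2]))
        intro a
        simp only [hb, Finset.mem_univ, iff_true]
        by_cases ha : a = a₁
        · have : y a - y a₂ = (2 / 3 : ℝ) • (y a₃ - y a₂) - (1 / 3 : ℝ) • (y a₄ - y a₂) := by
            simp only [y, ha, hu1, hu a₂ h12.symm, hu a₃ h13.symm, hu a₄ h14]
            module
          rw [this]
          exact Submodule.sub_mem _ (Submodule.smul_mem _ _ (hmem a₃ h13.symm))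
            (Submodule.smul_mem _ _ (hmem a₄ h14))
        · exact hmem a ha
    · have hb' : ∀ a ∈ N b, a ≠ a₁ ∧ a ≠ a₂ := by
        intro a ha
        have := Finset.disjoint_left.1 hb ha
        simp only [Finset.mem_insert, Finset.mem_singleton, not_or] at this
        exact ⟨this.1, this.2.1⟩
      refine ⟨0, Submodule.span ℝ (((N b).image y : Finset (EuclideanSpace ℝ (Fin d))) :
        Set (EuclideanSpace ℝ (Fin d))), by simp, ?_, fun a => ?_⟩
      · have h1 := finrank_span_finset_le_card (R := ℝ) ((N b).image y)
        rw [Set.finrank] at h1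
        have h2 := Finset.card_image_le (s := N b) (f := y)
        have h3 := Finset.card_le_univ (N b ∪ {a₁, a₂, a₃})
        rw [Finset.card_union_of_disjoint hb, hT, hA] at h3
        omega
      · rw [sub_zero]
        refine ⟨fun hmem => ?_, fun ha => Submodule.subset_span (Finset.mem_image_of_mem _ ha)⟩
        by_contra ha
        have hle : Submodule.span ℝ (((N b).image y : Finset (EuclideanSpace ℝ (Fin d))) :
            Set (EuclideanSpace ℝ (Fin d))) ≤
            LinearMap.ker (EuclideanSpace.proj (𝕜 := ℝ) (i a)).toLinearMap := by
          rw [Submodule.span_le]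
          intro p hp
          obtain ⟨a', ha', rfl⟩ := Finset.mem_image.1 hp
          have h1 := hb' a' ha'
          have hne : e a' ≠ i a := by
            by_cases haa : a = a₁
            · rw [haa, hi1]
              exact fun h => h1.2 (e.injective h)
            · rw [hi a haa]
              intro h
              exact ha (e.injective h ▸ ha')
          simp [y, hu a' h1.1, ε, hne.symm]
        have := hle hmem
        simp [y] at this
        exact hcoord a this)
  rw [Finset.empty_union] at hx
  exact hx.hasSphericalRep (by norm_num) (by norm_num) hy hyinj

end CoplanarQuadruple

section EitherSide

/-- With fewer than `(d + 2).choose 2` edges and no vertices of degree less than two in the class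
`A`, one of the two classes can be put on a small sphere. -/
theorem hasSphericalRep_or_hasSphericalRep_symm {A B : Type*} [Fintype A] [Fintype B]
    [DecidableEq A] [DecidableEq B] {d : ℕ} (hd : 4 ≤ d) (N : A → Finset B)
    (hN2 : ∀ a, 2 ≤ (N a).card) (hN : ∑ a, (N a).card < (d + 2).choose 2) :
    HasSphericalRep d N Finset.univ ∨
      HasSphericalRep d (fun b => Finset.univ.filter fun a => b ∈ N a) Finset.univ := by
  rcases hasSphericalRep_or_isConcentrated (by omega) hN with h | h
  · exact Or.inl h
  right
  set N' : B → Finset A := fun b => Finset.univ.filter fun a => b ∈ N a with hN'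
  -- at most one vertex of `A` lies outside the set on which the edges concentrate
  have hsd : ∀ W : Finset A, 2 * (Finset.univ \ W).card ≤ ∑ a ∈ Finset.univ \ W, (N a).card := by
    intro W
    have := Finset.card_nsmul_le_sum (Finset.univ \ W) (fun a => (N a).card) 2 fun a _ => hN2 a
    simpa [mul_comm] using this
  have hcW : ∀ W : Finset A, (Finset.univ \ W).card + W.card = Fintype.card A := fun W => by
    rw [Finset.card_sdiff_add_card_eq_card (Finset.subset_univ W), Finset.card_univ]
  have hA : Fintype.card A ≤ d := by
    rcases h with ⟨W, -, hW, hs⟩ | ⟨W, -, hW, hs, -⟩ <;>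
    · have := hsd W
      have := hcW W
      omega
  have hN'le : ∀ b, (N' b).card ≤ d := fun b => (Finset.card_le_univ _).trans hA
  by_cases h3 : (Finset.univ.filter fun b => d ≤ (N' b).card).card ≤ 2
  · exact hasSphericalRep_of_card_le (by omega) (fun b _ => hN'le b) h3
  -- three vertices of `B` are adjacent to all of `A`
  obtain ⟨F, hF, hF3⟩ := Finset.exists_subset_card_eq (not_le.1 h3)
  have hfull : ∀ b ∈ F, N' b = Finset.univ := by
    intro b hb
    have := (Finset.mem_filter.1 (hF hb)).2
    exact Finset.eq_univ_of_card _ (le_antisymm (Finset.card_le_univ _) (hA.trans this))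
  have hFN : ∀ a, F ⊆ N a := by
    intro a b hb
    have : a ∈ N' b := hfull b hb ▸ Finset.mem_univ a
    simpa [hN'] using this
  have hAd : Fintype.card A = d := by
    obtain ⟨b, hb⟩ := Finset.card_pos.1 (by omega : 0 < F.card)
    have := (Finset.mem_filter.1 (hF hb)).2
    rw [hfull b hb, Finset.card_univ] at this
    omega
  rcases h with ⟨W, -, hW, hs⟩ | ⟨W, -, -, -, T, -, hT3, hT⟩
  · exfalso
    have h1 := hcW W
    obtain ⟨a, ha⟩ := Finset.card_pos.1 (by omega : 0 < (Finset.univ \ W).card)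
    have h2 := Finset.single_le_sum (f := fun a => (N a).card) (fun _ _ => Nat.zero_le _) ha
    have h3 := Finset.card_le_card (hFN a)
    omega
  · refine hasSphericalRep_of_card_eq hd hAd Finset.univ T hT3 fun b => ?_
    by_cases hb : b ∈ F
    · exact Or.inl (hfull b hb)
    · refine Or.inr (Finset.disjoint_left.2 fun a ha haT => hb ?_)
      have : F = N a := Finset.eq_of_subset_of_card_le (hFN a) (by
        rw [hF3]
        exact hT a haT)
      rw [this]
      simpa [hN'] using ha

end EitherSide

/-! ### From spherical representations to faithful distance graphs -/

section Graphs

variable {V : Type*} {G : SimpleGraph V} {d : ℕ}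

/-- The map `f` realizes the subgraph of `G` induced on `P` as a faithful distance graph. -/
def IsFaithfulOn (G : SimpleGraph V) (P : Finset V) (f : V → EuclideanSpace ℝ (Fin d)) : Prop :=
  Set.InjOn f P ∧ ∀ u ∈ P, ∀ v ∈ P, dist (f u) (f v) = 1 ↔ G.Adj u v

theorem IsFaithfulOn.isFaithfullyRealizable [Fintype V] {f : V → EuclideanSpace ℝ (Fin d)}
    (h : IsFaithfulOn G Finset.univ f) : IsFaithfullyRealizable G d := by
  have hinj : Function.Injective f := fun u v e => h.1 (by simp) (by simp) e
  exact ⟨Set.range f, ⟨Equiv.ofInjective f hinj, fun {u v} => h.2 u (by simp) v (by simp)⟩⟩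

/-- A vertex with at most one neighbour can always be added to a faithful realization. -/
theorem IsFaithfulOn.exists_insert [DecidableEq V] (hd : 2 ≤ d) {P : Finset V}
    {f : V → EuclideanSpace ℝ (Fin d)} (h : IsFaithfulOn G P f) {v : V} (hv : v ∉ P)
    (hdeg : ∀ u ∈ P, ∀ w ∈ P, G.Adj v u → G.Adj v w → u = w) :
    ∃ f' : V → EuclideanSpace ℝ (Fin d), IsFaithfulOn G (insert v P) f' := by
  classical
  have hnt : Nontrivial (EuclideanSpace ℝ (Fin d)) := by
    apply Module.nontrivial_of_finrank_pos (R := ℝ)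
    rw [finrank_euclideanSpace_fin]
    omega
  -- `o` is the neighbour of `v`, if there is one
  obtain ⟨o, ho⟩ : ∃ o : EuclideanSpace ℝ (Fin d), ∀ u ∈ P, G.Adj v u ↔ o = f u := by
    by_cases hex : ∃ u ∈ P, G.Adj v u
    · obtain ⟨u, hu, huv⟩ := hex
      refine ⟨f u, fun w hw => ⟨fun hvw => congrArg f (hdeg u hu w hw huv hvw), fun e => ?_⟩⟩
      rwa [← h.1 hu hw e]
    · push Not at hex
      have : Infinite (EuclideanSpace ℝ (Fin d)) := Module.Free.infinite ℝ _
      obtain ⟨o, ho⟩ := Infinite.exists_notMem_finset (P.image f)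
      refine ⟨o, fun u hu => ⟨fun e => absurd e (hex u hu), fun e => absurd ?_ ho⟩⟩
      rw [e]
      exact Finset.mem_image_of_mem f hu
  obtain ⟨w, -, hw1, hw⟩ := exists_unit_inner_ne (⊤ : Submodule ℝ (EuclideanSpace ℝ (Fin d)))
    (by simpa using hd)
    (((P.filter fun u => o ≠ f u).image fun u => (o - f u, -‖o - f u‖ ^ 2 / 2)) ∪
      ((P.filter fun u => o ≠ f u).image fun u => (o - f u, (-1 - ‖o - f u‖ ^ 2) / 2))) (by
      intro p hp
      simp only [Finset.mem_union, Finset.mem_image, Finset.mem_filter] at hp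
      rcases hp with ⟨u, ⟨-, hu⟩, rfl⟩ | ⟨u, ⟨-, hu⟩, rfl⟩ <;>
      simpa [sub_eq_zero] using hu)
  have hexp : ∀ u, ‖o + w - f u‖ ^ 2 = ‖o - f u‖ ^ 2 + 1 + 2 * inner ℝ w (o - f u) := by
    intro u
    rw [add_sub_right_comm, norm_add_sq_real, hw1, real_inner_comm]
    ring
  have hdist : ∀ u ∈ P, dist (o + w) (f u) = 1 ↔ G.Adj v u := by
    intro u hu
    rw [ho u hu, dist_eq_norm]
    constructor
    · intro e
      by_contra hne
      have h1 := hexp u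
      rw [e] at h1
      refine hw _ (Finset.mem_union_left _
        (Finset.mem_image_of_mem _ (Finset.mem_filter.2 ⟨hu, hne⟩))) ?_
      simp only
      linarith
    · intro e
      rw [e, add_sub_cancel_left, hw1]
  have hdist0 : ∀ u ∈ P, o + w ≠ f u := by
    intro u hu e
    by_cases hne : o = f u
    · rw [← hne] at e
      have : w = 0 := by simpa using e
      rw [this, norm_zero] at hw1
      exact zero_ne_one hw1
    · have h1 := hexp u
      rw [e, sub_self, norm_zero] at h1
      refine hw _ (Finset.mem_union_right _
        (Finset.mem_image_of_mem _ (Finset.mem_filter.2 ⟨hu, hne⟩))) ?_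
      simp only
      linarith
  have hne : ∀ u ∈ P, u ≠ v := fun u hu e => hv (e ▸ hu)
  have hup : ∀ u ∈ P, Function.update f v (o + w) u = f u :=
    fun u hu => Function.update_of_ne (hne u hu) _ _
  refine ⟨Function.update f v (o + w), fun u hu u' hu' e => ?_, fun u hu u' hu' => ?_⟩
  · rcases Finset.mem_insert.1 hu with hu | hu <;> rcases Finset.mem_insert.1 hu' with hu' | hu'
    · rw [hu, hu']
    · rw [hu, Function.update_self, hup _ hu'] at e
      exact absurd e (hdist0 _ hu')
    · rw [hu', Function.update_self, hup _ hu] at e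
      exact absurd e.symm (hdist0 _ hu)
    · rw [hup _ hu, hup _ hu'] at e
      exact h.1 hu hu' e
  · rcases Finset.mem_insert.1 hu with hu | hu <;> rcases Finset.mem_insert.1 hu' with hu' | hu'
    · rw [hu, hu']
      simp
    · rw [hu, Function.update_self, hup _ hu']
      exact hdist _ hu'
    · rw [hu', Function.update_self, hup _ hu, dist_comm, G.adj_comm]
      exact hdist _ hu
    · rw [hup _ hu, hup _ hu']
      exact h.2 u hu u' hu'

theorem IsFaithfulOn.exists_union [DecidableEq V] (hd : 2 ≤ d) {P : Finset V}
    {f : V → EuclideanSpace ℝ (Fin d)} (h : IsFaithfulOn G P f) (T : Finset V)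
    (hdeg : ∀ v ∈ T, v ∉ P → ∀ u w, G.Adj v u → G.Adj v w → u = w) :
    ∃ f' : V → EuclideanSpace ℝ (Fin d), IsFaithfulOn G (P ∪ T) f' := by
  induction T using Finset.induction_on with
  | empty => exact ⟨f, by simpa using h⟩
  | insert v T _ ih =>
    obtain ⟨f', hf'⟩ := ih fun v hv => hdeg v (Finset.mem_insert_of_mem hv)
    rw [Finset.union_insert]
    by_cases hv : v ∈ P ∪ T
    · rw [Finset.insert_eq_of_mem hv]
      exact ⟨f', hf'⟩
    · exact hf'.exists_insert hd hv fun u _ w _ => hdeg v (Finset.mem_insert_self _ _)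
        (fun h => hv (Finset.mem_union_left _ h)) u w

/-- A spherical representation becomes a faithful realization after rescaling by `1 / √ρ`: the
remaining distances, those within `B`, are less than `√ρ` because `B` lies on a small sphere. -/
theorem HasSphericalRep.exists_isFaithfulOn {A B : Type*} [Fintype A] [Fintype B] [DecidableEq V]
    {N : A → Finset B} (h : HasSphericalRep d N Finset.univ) {i : A → V} {j : B → V}
    (hi : Function.Injective i) (hj : Function.Injective j) (hij : ∀ a b, i a ≠ j b)
    (hadj : ∀ a b, b ∈ N a ↔ G.Adj (i a) (j b)) (hA : ∀ a a', ¬ G.Adj (i a) (i a'))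
    (hB : ∀ b b', ¬ G.Adj (j b) (j b')) :
    ∃ f : V → EuclideanSpace ℝ (Fin d),
      IsFaithfulOn G (Finset.univ.image i ∪ Finset.univ.image j) f := by
  obtain ⟨ρ, σ, x, y, hσ, hρ, hinj, hy, hfar, hN, hsep⟩ := h
  have hρ0 : 0 < ρ := by linarith
  have hs0 : 0 < √ρ := Real.sqrt_pos.2 hρ0
  have hs2 : √ρ ^ 2 = ρ := Real.sq_sqrt hρ0.le
  have hc0 : (√ρ)⁻¹ ≠ 0 := inv_ne_zero hs0.ne'
  let f : V → EuclideanSpace ℝ (Fin d) :=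
    Function.extend i (fun a => (√ρ)⁻¹ • x a) (Function.extend j (fun b => (√ρ)⁻¹ • y b) 0)
  have hfi : ∀ a, f (i a) = (√ρ)⁻¹ • x a := fun a => hi.extend_apply _ _ a
  have hfj : ∀ b, f (j b) = (√ρ)⁻¹ • y b := by
    intro b
    simp only [f]
    rw [Function.extend_apply' _ _ _ (fun ⟨a, ha⟩ => hij a b ha), hj.extend_apply]
  have hdist : ∀ p q : EuclideanSpace ℝ (Fin d),
      dist ((√ρ)⁻¹ • p) ((√ρ)⁻¹ • q) = 1 ↔ ‖p - q‖ ^ 2 = ρ := by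
    intro p q
    rw [dist_eq_norm, ← smul_sub, norm_smul, norm_inv, Real.norm_eq_abs, abs_of_pos hs0,
      inv_mul_eq_one₀ hs0.ne', ← pow_left_inj₀ hs0.le (norm_nonneg _) two_ne_zero, hs2, eq_comm]
  have hyy : ∀ b b', ‖y b - y b'‖ ^ 2 ≠ ρ := by
    intro b b'
    have h1 := parallelogram_law_with_norm ℝ (y b) (y b')
    have h2 := mul_self_nonneg ‖y b + y b'‖
    have h3 := hy b
    have h4 := hy b'
    apply ne_of_lt
    nlinarith
  have hxy : ∀ a b, x a ≠ y b := by
    intro a b e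
    have := hfar a (Finset.mem_univ _)
    rw [e, hy] at this
    exact lt_irrefl _ this
  have hmem : ∀ v ∈ Finset.univ.image i ∪ Finset.univ.image j,
      (∃ a, i a = v) ∨ ∃ b, j b = v := by
    intro v hv
    simpa using hv
  refine ⟨f, fun u hu v hv e => ?_, fun u hu v hv => ?_⟩
  · rcases hmem u hu with ⟨a, rfl⟩ | ⟨b, rfl⟩ <;> rcases hmem v hv with ⟨a', rfl⟩ | ⟨b', rfl⟩
    · rw [hfi, hfi] at e
      have e' := smul_right_injective _ hc0 e
      by_contra hne
      exact (hsep a (Finset.mem_univ _) a' (Finset.mem_univ _) fun h => hne (congrArg i h)).1 e'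
    · rw [hfi, hfj] at e
      exact absurd (smul_right_injective _ hc0 e) (hxy a b')
    · rw [hfi, hfj] at e
      exact absurd (smul_right_injective _ hc0 e).symm (hxy a' b)
    · rw [hfj, hfj] at e
      rw [hinj (smul_right_injective _ hc0 e)]
  · rcases hmem u hu with ⟨a, rfl⟩ | ⟨b, rfl⟩ <;> rcases hmem v hv with ⟨a', rfl⟩ | ⟨b', rfl⟩
    · rw [hfi, hfi, hdist]
      refine iff_of_false (fun e => ?_) (hA a a')
      by_cases haa : a = a'
      · rw [haa, sub_self, norm_zero] at e
        linarith
      · exact (hsep a (Finset.mem_univ _) a' (Finset.mem_univ _) haa).2 e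
    · rw [hfi, hfj, hdist, ← hadj]
      exact hN a (Finset.mem_univ _) b'
    · rw [hfi, hfj, hdist, G.adj_comm, ← hadj, norm_sub_rev]
      exact hN a' (Finset.mem_univ _) b
    · rw [hfj, hfj, hdist]
      exact iff_of_false (hyy b b') (hB b b')

theorem isFaithfullyRealizable_of_card_edgeSet_lt [Finite V] (hd : 4 ≤ d) (hG : G.IsBipartite)
    (he : G.edgeSet.ncard < (d + 2).choose 2) : IsFaithfullyRealizable G d := by
  classical
  have := Fintype.ofFinite V
  obtain ⟨s, t, hst⟩ := hG.exists_isBipartiteWith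
  have hin : ∀ u v, u ∈ s → v ∈ s → ¬ G.Adj u v := by
    intro u v hu hv h
    rcases hst.mem_of_adj h with ⟨-, h'⟩ | ⟨h', -⟩
    · exact Set.disjoint_left.1 hst.disjoint hv h'
    · exact Set.disjoint_left.1 hst.disjoint hu h'
  have hout : ∀ u v, u ∉ s → v ∉ s → ¬ G.Adj u v := by
    intro u v hu hv h
    rcases hst.mem_of_adj h with ⟨h', -⟩ | ⟨-, h'⟩
    · exact hu h'
    · exact hv h'
  let A := {v : V // v ∈ s ∧ 2 ≤ G.degree v}
  let B := {v : V // v ∉ s}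
  let i : A → V := Subtype.val
  let j : B → V := Subtype.val
  have hi : Function.Injective i := Subtype.val_injective
  have hj : Function.Injective j := Subtype.val_injective
  have hij : ∀ a b, i a ≠ j b := fun a b e => b.2 ((show a.1 = b.1 from e) ▸ a.2.1)
  let N : A → Finset B := fun a => Finset.univ.filter fun b => G.Adj (i a) (j b)
  have hN : ∀ a b, b ∈ N a ↔ G.Adj (i a) (j b) := by simp [N]
  have hdeg : ∀ a, (N a).card = G.degree (i a) := by
    intro a
    rw [← SimpleGraph.card_neighborFinset_eq_degree, ← Finset.card_image_of_injective (N a) hj]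
    congr 1
    ext v
    simp only [Finset.mem_image, hN, SimpleGraph.mem_neighborFinset]
    constructor
    · rintro ⟨b, hb, rfl⟩
      exact hb
    · intro hv
      exact ⟨⟨v, fun hvs => hin _ _ a.2.1 hvs hv⟩, hv, rfl⟩
  have hsum : ∑ a, (N a).card < (d + 2).choose 2 := by
    refine lt_of_le_of_lt ?_ he
    have hst' : G.IsBipartiteWith (s.toFinset : Set V) (t.toFinset : Set V) := by simpa using hst
    have h1 := SimpleGraph.isBipartiteWith_sum_degrees_eq_card_edges hst'
    rw [← SimpleGraph.coe_edgeFinset, Set.ncard_coe_finset, ← h1]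
    simp only [hdeg]
    rw [← Finset.sum_image (f := fun v => G.degree v) (g := i) (s := Finset.univ)
      fun a _ a' _ e => hi e]
    refine Finset.sum_le_sum_of_subset fun v hv => ?_
    obtain ⟨a, -, rfl⟩ := Finset.mem_image.1 hv
    exact Set.mem_toFinset.2 a.2.1
  obtain ⟨f, hf⟩ : ∃ f : V → EuclideanSpace ℝ (Fin d),
      IsFaithfulOn G (Finset.univ.image i ∪ Finset.univ.image j) f := by
    rcases hasSphericalRep_or_hasSphericalRep_symm hd N
      (fun a => (hdeg a).symm ▸ a.2.2) hsum with h | h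
    · exact h.exists_isFaithfulOn hi hj hij hN (fun a a' => hin _ _ a.2.1 a'.2.1)
        fun b b' => hout _ _ b.2 b'.2
    · rw [Finset.union_comm]
      exact h.exists_isFaithfulOn hj hi (fun b a => (hij a b).symm)
        (fun b a => by rw [Finset.mem_filter, hN, G.adj_comm]; simp)
        (fun b b' => hout _ _ b.2 b'.2) fun a a' => hin _ _ a.2.1 a'.2.1
  -- the vertices that are left have degree at most one
  obtain ⟨f', hf'⟩ := hf.exists_union (by omega) Finset.univ (by
    intro v _ hv u w hu hw
    simp only [Finset.mem_union, Finset.mem_image, Finset.mem_univ, true_and, not_or,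
      not_exists] at hv
    have hvs : v ∈ s := by
      by_contra h
      exact hv.2 ⟨v, h⟩ rfl
    have hvd : (G.neighborFinset v).card ≤ 1 := by
      by_contra h
      rw [SimpleGraph.card_neighborFinset_eq_degree] at h
      exact hv.1 ⟨v, hvs, by omega⟩ rfl
    exact Finset.card_le_one.1 hvd u (by simpa using hu) w (by simpa using hw))
  rw [Finset.union_eq_right.2 (Finset.subset_univ _)] at hf'
  exact hf'.isFaithfullyRealizable

end Graphs

/-! ### A bipartite graph that is not realizable -/

section UpperBound

/-- The bipartite graph with classes `a₀, …, a_{d-1}` (on the left) and `b₀, …, b_{d-1}` (on the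
right), in which `b₀`, `b₁`, `b₂` are adjacent to all `a_j` and every other `b_i` is adjacent to
those `a_j` with `j < i`. -/
def halfGraph (d : ℕ) : SimpleGraph (Fin d ⊕ Fin d) where
  Adj
    | .inl j, .inr i => i.val < 3 ∨ j < i
    | .inr i, .inl j => i.val < 3 ∨ j < i
    | _, _ => False
  symm := ⟨by rintro (j | i) (j' | i') h <;> exact h⟩
  loopless := ⟨by rintro (j | i) h <;> exact h⟩

theorem halfGraph_isBipartiteWith (d : ℕ) : (halfGraph d).IsBipartiteWith
    ((Finset.univ.map ⟨Sum.inr, Sum.inr_injective⟩ : Finset (Fin d ⊕ Fin d)) : Set (Fin d ⊕ Fin d))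
    ((Finset.univ.map ⟨Sum.inl, Sum.inl_injective⟩ : Finset (Fin d ⊕ Fin d)) :
      Set (Fin d ⊕ Fin d)) where
  disjoint := by
    rw [Set.disjoint_left]
    rintro (j | i) h <;> simp at h ⊢
  mem_of_adj := by
    rintro (j | i) (j' | i') h
    · exact h.elim
    · simp
    · simp
    · exact h.elim

theorem sum_range_ite_lt_three (D m : ℕ) :
    2 * ∑ i ∈ Finset.range (m + 3), (if i < 3 then D else i) = 6 * D + m * (m + 5) := by
  induction m with
  | zero =>
    simp [Finset.sum_range_succ]
    ring
  | succ m ih =>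
    rw [show m + 1 + 3 = m + 3 + 1 by ring, Finset.sum_range_succ, mul_add, ih,
      if_neg (by omega)]
    ring

theorem ncard_edgeSet_halfGraph {d : ℕ} (hd : 3 ≤ d) :
    (halfGraph d).edgeSet.ncard + 6 = (d + 3).choose 2 := by
  classical
  rw [← SimpleGraph.coe_edgeFinset, Set.ncard_coe_finset,
    ← SimpleGraph.isBipartiteWith_sum_degrees_eq_card_edges (halfGraph_isBipartiteWith d),
    Finset.sum_map]
  have hdeg : ∀ i : Fin d, (halfGraph d).degree (Sum.inr i) = if i.val < 3 then d else i.val := by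
    intro i
    have : (halfGraph d).neighborFinset (Sum.inr i) =
        (Finset.univ.filter fun j : Fin d => i.val < 3 ∨ j < i).map
          ⟨Sum.inl, Sum.inl_injective⟩ := by
      ext v
      rw [SimpleGraph.mem_neighborFinset]
      rcases v with j | i' <;> simp [halfGraph]
    rw [← SimpleGraph.card_neighborFinset_eq_degree, this, Finset.card_map]
    split_ifs with hi
    · simp [hi]
    · have : (Finset.univ.filter fun j : Fin d => i.val < 3 ∨ j < i) = Finset.Iio i := by
        ext j
        simp [hi]
      rw [this, Fin.card_Iio]
  have hsum : ∑ i : Fin d, (halfGraph d).degree (Sum.inr i) =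
      ∑ i ∈ Finset.range d, if i < 3 then d else i := by
    rw [← Fin.sum_univ_eq_sum_range fun i => if i < 3 then d else i]
    exact Finset.sum_congr rfl fun i _ => hdeg i
  simp only [Function.Embedding.coeFn_mk]
  rw [hsum]
  obtain ⟨m, rfl⟩ : ∃ m, d = m + 3 := ⟨d - 3, by omega⟩
  have h1 := sum_range_ite_lt_three (m + 3) m
  have h2 := Nat.choose_two_right (m + 3 + 3)
  have h3 : 2 * (m + 3 + 3).choose 2 = (m + 6) * (m + 5) := by
    rw [h2, Nat.mul_div_cancel' (Nat.even_mul_pred_self _).two_dvd]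
    congr 1
  nlinarith

theorem two_mul_inner_sub_sub {E : Type*} [NormedAddCommGroup E] [InnerProductSpace ℝ E]
    (a a' b b' : E) : 2 * inner ℝ (a - a') (b - b') =
      dist a b' ^ 2 + dist a' b ^ 2 - dist a b ^ 2 - dist a' b' ^ 2 := by
  simp only [dist_eq_norm, norm_sub_sq_real, inner_sub_left, inner_sub_right]
  ring

theorem finrank_vectorSpan_of_dist_eq_one {E : Type*} [NormedAddCommGroup E]
    [InnerProductSpace ℝ E] {p₁ p₂ p₃ c : E} (h12 : p₁ ≠ p₂) (h13 : p₁ ≠ p₃) (h23 : p₂ ≠ p₃)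
    (h1 : dist p₁ c = 1) (h2 : dist p₂ c = 1) (h3 : dist p₃ c = 1) :
    Module.finrank ℝ (vectorSpan ℝ (Set.range ![p₁, p₂, p₃])) = 2 := by
  have hc : EuclideanGeometry.Cospherical ({p₁, p₂, p₃} : Set E) := ⟨c, 1, by simp [h1, h2, h3]⟩
  exact (hc.affineIndependent_of_ne h12 h13 h23).finrank_vectorSpan (by simp)

/-- In a faithful realization of the graph, the points `a₀, …, a_{d-1}` would be affinely
independent: `a_k` is not in the affine span of its predecessors, because these are equidistant
from `b_k` and `b₀`, and `a_k` is not. But the lines through `b₀`, `b₁`, `b₂` span a plane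
orthogonal to all differences of these points. -/
theorem not_isFaithfullyRealizable_halfGraph {d : ℕ} (hd : 3 ≤ d) :
    ¬ IsFaithfullyRealizable (halfGraph d) d := by
  rintro ⟨S, ⟨φ⟩⟩
  let a : Fin d → EuclideanSpace ℝ (Fin d) := fun j => (φ (Sum.inl j) : EuclideanSpace ℝ (Fin d))
  let b : Fin d → EuclideanSpace ℝ (Fin d) := fun i => (φ (Sum.inr i) : EuclideanSpace ℝ (Fin d))
  have ha : Function.Injective a := Subtype.val_injective.comp (φ.injective.comp Sum.inl_injective)
  have hb : Function.Injective b := Subtype.val_injective.comp (φ.injective.comp Sum.inr_injective)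
  have hab : ∀ j i, dist (a j) (b i) = 1 ↔ i.val < 3 ∨ j < i := fun j i =>
    φ.map_rel_iff (a := Sum.inl j) (b := Sum.inr i)
  let i0 : Fin d := ⟨0, by omega⟩
  let i1 : Fin d := ⟨1, by omega⟩
  let i2 : Fin d := ⟨2, by omega⟩
  have h01 : i0 ≠ i1 := by simp [i0, i1]
  have h02 : i0 ≠ i2 := by simp [i0, i2]
  have h12 : i1 ≠ i2 := by simp [i1, i2]
  have hall : ∀ j (i : Fin d), i.val < 3 → dist (a j) (b i) = 1 :=
    fun j i h => (hab j i).2 (Or.inl h)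
  have hrank : ∀ k, 3 ≤ k → k ≤ d →
      k ≤ Module.finrank ℝ (vectorSpan ℝ (a '' {j | j.val < k})) + 1 := by
    intro k hk
    induction k, hk using Nat.le_induction with
    | base =>
      intro _
      have h := finrank_vectorSpan_of_dist_eq_one (ha.ne h01) (ha.ne h02) (ha.ne h12)
        (hall i0 i0 (by simp [i0])) (hall i1 i0 (by simp [i0])) (hall i2 i0 (by simp [i0]))
      have hle : Set.range ![a i0, a i1, a i2] ⊆ a '' {j | j.val < 3} := by
        rintro _ ⟨k, rfl⟩
        fin_cases k
        · exact ⟨i0, by simp [i0], rfl⟩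
        · exact ⟨i1, by simp [i1], rfl⟩
        · exact ⟨i2, by simp [i2], rfl⟩
      have := Submodule.finrank_mono (vectorSpan_mono ℝ hle)
      omega
    | succ k hk ih =>
      intro hkd
      let c : Fin d := ⟨k, by omega⟩
      have hlt : vectorSpan ℝ (a '' {j | j.val < k}) <
          vectorSpan ℝ (a '' {j | j.val < k + 1}) := by
        refine lt_of_le_of_ne (vectorSpan_mono ℝ (Set.image_mono fun j (hj : j.val < k) =>
          Nat.lt_succ_of_lt hj)) fun heq => ?_
        have hmem : a c - a i0 ∈ vectorSpan ℝ (a '' {j | j.val < k}) := by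
          rw [heq]
          exact vsub_mem_vectorSpan ℝ ⟨c, Nat.lt_succ_self k, rfl⟩ ⟨i0, Nat.succ_pos k, rfl⟩
        have hle : vectorSpan ℝ (a '' {j | j.val < k}) ≤ (Submodule.span ℝ {b c - b i0})ᗮ := by
          rw [vectorSpan_def, Submodule.span_le]
          rintro _ ⟨_, ⟨j, hj, rfl⟩, _, ⟨j', hj', rfl⟩, rfl⟩
          rw [SetLike.mem_coe, Submodule.mem_orthogonal_singleton_iff_inner_left]
          have h := two_mul_inner_sub_sub (a j) (a j') (b c) (b i0)
          rw [hall j i0 (by simp [i0]), hall j' i0 (by simp [i0]), (hab j c).2 (Or.inr hj),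
            (hab j' c).2 (Or.inr hj')] at h
          simp only [vsub_eq_sub]
          linarith
        have h0 := Submodule.mem_orthogonal_singleton_iff_inner_left.1 (hle hmem)
        have h := two_mul_inner_sub_sub (a c) (a i0) (b c) (b i0)
        rw [h0, hall c i0 (by simp [i0]), hall i0 i0 (by simp [i0]),
          (hab i0 c).2 (Or.inr (Fin.mk_lt_mk.2 (by omega)))] at h
        have h1 : dist (a c) (b c) = 1 := by
          rw [← pow_left_inj₀ dist_nonneg zero_le_one two_ne_zero]
          linarith
        rcases (hab c c).1 h1 with h | h
        · exact absurd h (by simpa [c] using hk)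
        · exact lt_irrefl _ h
      have := Submodule.finrank_lt_finrank_of_lt hlt
      have := ih (by omega)
      omega
  have hbrank := finrank_vectorSpan_of_dist_eq_one (hb.ne h01) (hb.ne h02) (hb.ne h12)
    (c := a i0) (by rw [dist_comm]; exact hall i0 i0 (by simp [i0]))
    (by rw [dist_comm]; exact hall i0 i1 (by simp [i1]))
    (by rw [dist_comm]; exact hall i0 i2 (by simp [i2]))
  have hsmall : ∀ p ∈ Set.range ![b i0, b i1, b i2], ∀ j, dist (a j) p = 1 := by
    rintro _ ⟨k, rfl⟩ j
    fin_cases k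
    · exact hall j i0 (by simp [i0])
    · exact hall j i1 (by simp [i1])
    · exact hall j i2 (by simp [i2])
  have hle : vectorSpan ℝ (a '' {j | j.val < d}) ≤
      (vectorSpan ℝ (Set.range ![b i0, b i1, b i2]))ᗮ := by
    rw [Submodule.le_orthogonal_iff_le_orthogonal, vectorSpan_def, Submodule.span_le]
    rintro _ ⟨p, hp, q, hq, rfl⟩
    rw [SetLike.mem_coe, Submodule.mem_orthogonal]
    intro z hz
    rw [vectorSpan_def] at hz
    induction hz using Submodule.span_induction with
    | mem z hz =>
      obtain ⟨_, ⟨j, -, rfl⟩, _, ⟨j', -, rfl⟩, rfl⟩ := hz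
      have h := two_mul_inner_sub_sub (a j) (a j') p q
      rw [hsmall p hp, hsmall p hp, hsmall q hq, hsmall q hq] at h
      simp only [vsub_eq_sub]
      linarith
    | zero => exact inner_zero_left _
    | add z z' _ _ h h' => rw [inner_add_left, h, h', add_zero]
    | smul t z _ h => rw [real_inner_smul_left, h, mul_zero]
  have h1 := Submodule.finrank_mono hle
  have h2 := (vectorSpan ℝ (Set.range ![b i0, b i1, b i2])).finrank_add_finrank_orthogonal
  rw [finrank_euclideanSpace_fin, hbrank] at h2
  have h3 := hrank d hd le_rfl
  omega

end UpperBound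

theorem theorem3 (d : ℕ) (hd : 4 ≤ d) :
    IsLeast (nonRealizableBipartiteEdgeCounts d) (g₂ d) ∧
      (d + 2).choose 2 ≤ g₂ d ∧
      (g₂ d : ℤ) ≤ ((d + 3).choose 2 : ℤ) - 6 := by
  have hmem : (halfGraph d).edgeSet.ncard ∈ nonRealizableBipartiteEdgeCounts d :=
    ⟨Fin d ⊕ Fin d, inferInstance, halfGraph d, (halfGraph_isBipartiteWith d).isBipartite,
      not_isFaithfullyRealizable_halfGraph (by omega), rfl⟩
  have hleast : IsLeast (nonRealizableBipartiteEdgeCounts d) (g₂ d) :=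
    ⟨Nat.sInf_mem ⟨_, hmem⟩, fun m hm => Nat.sInf_le hm⟩
  refine ⟨hleast, ?_, ?_⟩
  · obtain ⟨V, hV, G, hG, hreal, hcard⟩ := hleast.1
    by_contra hlt
    exact hreal (isFaithfullyRealizable_of_card_edgeSet_lt hd hG (by omega))
  · have h1 := hleast.2 hmem
    have h2 := ncard_edgeSet_halfGraph (d := d) (by omega)
    omega
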